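/- Let $m\ge 2$ and $t\ge s\ge 2$ be integers, and let $\varphi$ be the substitution on the alphabet $\mathcal A=\{0,1,\dots,m-1\}$ given by $$\varphi(a)=0^t(a+1)\quad(0\le a\le m-2),\qquad \varphi(m-1)=0^s .$$ Let $u=\lim_{n\to\infty}\varphi^n(0)$ be its unique right-infinite fixed point, and let $\mathcal P(n)$ be the number of palindromes of length $n$ that are factors of $u$. Define finite words by $$V^{(1)}=0^t,\quad U^{(1)}=0^{t+s-1},\qquad V^{(k)}=\varphi(V^{(k-1)})0^t,\quad U^{(k)}=\varphi(U^{(k-1)})0^t\quad(k\ge2),$$ and write $|w|$ for the length of a word $w$. Below, $k$ ranges over integers $k\ge 1$, and the formulas hold for all integers $n\ge 0$. (i) If $s$ is odd and $t$ is even, then $\mathcal P(2n+1)=m$ and $$\mathcal P(2n)=\begin{cases}2,&\text{if }|V^{(k)}|<2n\le|U^{(k)}|\text{ for some }k,\\ 1,&\text{otherwise.}\end{cases}$$ (ii) If $s$ and $t$ are both odd, then $$\mathcal P(2n+1)=\begin{cases}m+1,&\text{if }|V^{(k)}|<2n+1\le|U^{(k)}|\text{ for some }k\text{ with }k\not\equiv0\pmod{m+1},\\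 m,&\text{otherwise,}\end{cases}$$ $$\mathcal P(2n)=\begin{cases}2,&\text{if }|V^{(k)}|<2n\le|U^{(k)}|\text{ for some }k\text{ with }k\equiv0\pmod{m+1},\\ 1,&\text{otherwise.}\end{cases}$$ (iii) If $s$ is even and $t$ is odd, then $$\mathcal P(2n+1)=\begin{cases}m+2,&\text{if }|V^{(k)}|<2n+1\le|U^{(k)}|\text{ for some }k\ge2,\\ m,&\text{if }2n+1\le|V^{(1)}|,\\ m+1,&\text{otherwise,}\end{cases}$$ $$\mathcal P(2n)=\begin{cases}1,&\text{if }2n\le|U^{(1)}|=t+s-1,\\ 0,&\text{otherwise.}\end{cases}$$ (iv) If $s$ and $t$ are both even, then $$\mathcal P(2n+1)=\begin{cases}\#\{k\le m : 2n+1\le|U^{(k)}|\},&\text{if }2n+1\le|U^{(m)}|,\\ 0,&\text{otherwise,}\end{cases}$$ $$\mathcal P(2n)=\begin{cases}m+2,&\text{if }|V^{(k)}|<2n\le|U^{(k)}|\text{ for some }k\ge m+1,\\ \#\{k\le m : 2n>|V^{(k)}|\}+1,&\text{if }2n\le|V^{(m+1)}|,\\ m+1,&\text{otherwise.}\end{cases}$$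 -/

import Mathlib

/-! Finite words over an alphabet `A` are lists, right infinite words are functions `ℕ → A`. -/

namespace ParryPal

/-- The prefix `u₀ u₁ ⋯ uₙ₋₁` of length `n` of the infinite word `u`. -/
def pref {A : Type*} (u : ℕ → A) (n : ℕ) : List A :=
  (List.range n).map u

/-- The finite word `w` is a factor of the infinite word `u`. -/
def IsFactor {A : Type*} (u : ℕ → A) (w : List A) : Prop :=
  ∃ i : ℕ, w = (List.range w.length).map (fun j => u (i + j))

/-- The palindromic complexity: the number of palindromes of length `n` among the factors
of `u`. (For a finite alphabet the set that is counted is finite.) -/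
noncomputable def palComplexity {A : Type*} (u : ℕ → A) (n : ℕ) : ℕ :=
  {w : List A | IsFactor u w ∧ w.length = n ∧ w.reverse = w}.ncard

/-- The action on finite words of the morphism with letter images `φ`. -/
def applyMorphism {A : Type*} (φ : A → List A) (w : List A) : List A :=
  w.flatMap φ

/-- `φ(u) = u` for a right infinite word `u`: every image `φ(u₀) φ(u₁) ⋯ φ(uₙ₋₁)` is a prefix
of `u`. (For a non-erasing `φ` the lengths of these images are unbounded.) -/
def IsFixedPoint {A : Type*} (φ : A → List A) (u : ℕ → A) : Prop :=
  ∀ n : ℕ, applyMorphism φ (pref u n) = pref u (applyMorphism φ (pref u n)).length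

/-- The substitution `a ↦ 0^t (a+1)` for `a ≠ m - 1`, and `m - 1 ↦ 0^s`, on the alphabet
`{0, 1, …, m - 1}`. -/
def confSubst (m t s : ℕ) [NeZero m] (a : Fin m) : List (Fin m) :=
  if h : (a : ℕ) + 1 < m then List.replicate t 0 ++ [⟨(a : ℕ) + 1, h⟩]
  else List.replicate s 0

/-- The words `V^(1) = 0^t`, `V^(k) = φ(V^(k-1)) 0^t` for `k ≥ 2`. The value at `0` is a
placeholder. -/
def palV (m t s : ℕ) [NeZero m] : ℕ → List (Fin m)
  | 0 => []
  | 1 => List.replicate t 0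
  | k + 2 => applyMorphism (confSubst m t s) (palV m t s (k + 1)) ++ List.replicate t 0

/-- The words `U^(1) = 0^(t+s-1)`, `U^(k) = φ(U^(k-1)) 0^t` for `k ≥ 2`. The value at `0` is a
placeholder. -/
def palU (m t s : ℕ) [NeZero m] : ℕ → List (Fin m)
  | 0 => []
  | 1 => List.replicate (t + s - 1) 0
  | k + 2 => applyMorphism (confSubst m t s) (palU m t s (k + 1)) ++ List.replicate t 0

/-! The substitution has exactly one fixed point. -/

theorem applyMorphism_prefix {A : Type*} (φ : A → List A) {v w : List A} (h : v <+: w) :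
    applyMorphism φ v <+: applyMorphism φ w := by
  obtain ⟨r, rfl⟩ := h
  exact ⟨r.flatMap φ, by simp [applyMorphism]⟩

theorem pref_length {A : Type*} (u : ℕ → A) (n : ℕ) : (pref u n).length = n := by
  simp [pref]

theorem eq_pref_of_prefix {A : Type*} (u : ℕ → A) {v : List A} {n : ℕ} (h : v <+: pref u n) :
    v = pref u v.length := by
  apply List.ext_getElem
  · simp [pref]
  · intro i h1 h2
    rw [h.getElem h1]
    simp [pref]

theorem pref_prefix {A : Type*} (u : ℕ → A) {k n : ℕ} (h : k ≤ n) : pref u k <+: pref u n := by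
  obtain ⟨d, rfl⟩ := Nat.exists_eq_add_of_le h
  exact ⟨(List.range d).map (fun i => u (k + i)), by simp [pref, List.range_add, Function.comp_def]⟩

theorem length_le_applyMorphism {A : Type*} (φ : A → List A) (h : ∀ a, φ a ≠ []) (w : List A) :
    w.length ≤ (applyMorphism φ w).length := by
  induction w with
  | nil => simp
  | cons a w ih =>
    have := List.length_pos_iff.2 (h a)
    simp only [applyMorphism, List.flatMap_cons, List.length_append, List.length_cons] at ih ⊢
    omega

theorem existsUnique_isFixedPoint (m t s : ℕ) [NeZero m] (hm : 2 ≤ m) (ht : 1 ≤ t)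
    (hs : 1 ≤ s) : ∃! u : ℕ → Fin m, IsFixedPoint (confSubst m t s) u := by
  obtain ⟨t, rfl⟩ := Nat.exists_eq_add_of_le' ht
  obtain ⟨s, rfl⟩ := Nat.exists_eq_add_of_le' hs
  set φ := confSubst m (t + 1) (s + 1) with hφ
  have hhead : ∀ a, ∃ r, φ a = 0 :: r := by
    intro a
    by_cases h : (a : ℕ) + 1 < m <;> simp [hφ, confSubst, h, List.replicate_succ]
  have hne : ∀ a, φ a ≠ [] := by
    intro a
    obtain ⟨r, hr⟩ := hhead a
    simp [hr]
  obtain ⟨r0, hr0, hr0'⟩ : ∃ r, φ 0 = 0 :: r ∧ 1 ≤ r.length := by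
    refine ⟨List.replicate t 0 ++ [⟨1, hm⟩], ?_, by simp⟩
    have : 1 < m := hm
    simp [hφ, confSubst, this, List.replicate_succ]
  let w : ℕ → List (Fin m) := fun k => (applyMorphism φ)^[k] [0]
  have hw0 : w 0 = [0] := rfl
  have hws : ∀ k, w (k + 1) = applyMorphism φ (w k) := fun k =>
    Function.iterate_succ_apply' _ _ _
  have hstep : ∀ k, w k <+: w (k + 1) := by
    intro k
    induction k with
    | zero => rw [hws, hw0]; exact ⟨r0, by simp [applyMorphism, hr0]⟩
    | succ k ih => rw [hws k, hws (k + 1)]; exact applyMorphism_prefix φ ih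
  have hmono : ∀ k d, w k <+: w (k + d) := by
    intro k d
    induction d with
    | zero => exact List.prefix_refl _
    | succ d ih => exact ih.trans (hstep (k + d))
  have hlen : ∀ k, k + 1 ≤ (w k).length := by
    intro k
    induction k with
    | zero => simp [hw0]
    | succ k ih =>
      obtain ⟨r, hr⟩ : ∃ r, w k = 0 :: r := by
        obtain ⟨r, hr⟩ := hmono 0 k
        refine ⟨r, ?_⟩
        rw [zero_add] at hr
        rw [← hr, hw0]
        rfl
      have h1 := length_le_applyMorphism φ hne r
      rw [hws k, hr]
      rw [hr] at ih
      simp only [applyMorphism, List.flatMap_cons, List.length_append, List.length_cons,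
        hr0] at h1 ih ⊢
      omega
  let u : ℕ → Fin m := fun n => (w n)[n]'(hlen n)
  have hu : ∀ k, w k = pref u (w k).length := by
    intro k
    apply List.ext_getElem
    · simp [pref]
    · intro i h1 h2
      simp only [pref, List.getElem_map, List.getElem_range, u]
      rcases le_total i k with h | h
      · obtain ⟨d, rfl⟩ := Nat.exists_eq_add_of_le h
        exact ((hmono i d).getElem (hlen i)).symm
      · obtain ⟨d, rfl⟩ := Nat.exists_eq_add_of_le h
        exact (hmono k d).getElem h1
  refine ⟨u, ?_, ?_⟩
  · intro n
    have h1 : pref u n <+: w n := by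
      rw [hu n]
      exact pref_prefix u ((Nat.le_succ n).trans (hlen n))
    have h2 := applyMorphism_prefix φ h1
    rw [← hws, hu (n + 1)] at h2
    exact eq_pref_of_prefix u h2
  · intro v hv
    have hv0 : v 0 = 0 := by
      have := hv 1
      obtain ⟨r, hr⟩ := hhead (v 0)
      have h2 := congrArg List.head? this
      simpa [pref, applyMorphism, hr, List.range_succ_eq_map] using h2.symm
    have hvw : ∀ k, w k = pref v (w k).length := by
      intro k
      induction k with
      | zero => simp [hw0, pref, hv0]
      | succ k ih =>
        rw [hws, ih]
        exact hv _
    funext n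
    have h1 : (w n)[n]'(hlen n) = v n := by
      have := List.getElem_of_eq (hvw n) (hlen n)
      simpa [pref] using this
    exact h1.symm

end ParryPal

open ParryPal

/-!
Why the formulas hold. Write `φ` for the substitution. The fixed point `u` is cut into the blocks
`φ(u 0)`, `φ(u 1)`, …, and the letter at distance `t` from the start of the `n`-th block is always
`u n + 1`, with addition modulo `m`: if `u n = m - 1`, the block `0^s` is followed by `0^t 1`.
The nonzero letters of `u` are exactly the last letters of the blocks `0^t (a+1)`, so an
occurrence of a nonzero letter locates the blocks. Hence `φ(w) 0^t` occurs at the start of the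
`n`-th block if and only if `w` occurs at `n` (`occursAt_palLift_iff`), and, for `w`
nonempty and not starting with `m - 1`, `(c+1) φ(w) 0^t (d+1)` is a factor if and only if `c w d` is
(`isFactor_cons_palLift_iff`).

Consider the palindromic extensions `c p c` of a palindromic factor `p`. If `p` starts with exactly
`i` zeros followed by a nonzero letter and `i ≠ t`, both neighbours of `p` are forced by `i`, and
there is one extension. If `i = t`, then `p = φ(q) 0^t` for a shorter palindrome `q` with as many
extensions. The powers of `0` are treated by hand: `0^t` has two extensions, `0^(t+s-1)` has
none, the others have one. By induction every palindromic factor has one palindromic extension,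
except that `V^(k)` has two and `U^(k)` has none (`ncard_palExt`). Therefore
`P(n+2) - P(n)` is the number of `V^(k)` of length `n` minus the number of `U^(k)` of length `n`,
and with `P(0) = 1`, `P(1) = m` this determines `P` from the lengths (`palComplexity_add_card`).

Two facts on the lengths remain. They interlace, `|V^(k)| < |U^(k)| < |V^(k+1)|`, since `0 V^(k)` is
a subsequence of `U^(k)` and `0 U^(k)` one of `V^(k+1)`. Their parities follow from the letter
counts modulo 2: these counts are always all zero or a unit vector, and `w ↦ φ(w) 0^t` shifts the unit
vector, the only further rules being what happens to the zero vector and to the last unit vector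
(`AllEven`, `OddOnly`).
-/

namespace ParryPal

/-! ### Occurrences of finite words -/

section Words

variable {A : Type*} {u : ℕ → A}

/-- The finite word `w` occurs in `u` at position `i`. -/
def OccursAt (u : ℕ → A) : ℕ → List A → Prop
  | _, [] => True
  | i, a :: w => u i = a ∧ OccursAt u (i + 1) w

/-- The palindromic extensions of `w`: the letters `c` such that `c w c` is a factor of `u`. -/
def palExt (u : ℕ → A) (w : List A) : Set A :=
  {c | IsFactor u (c :: w ++ [c])}

theorem occursAt_append {i : ℕ} {v w : List A} :
    OccursAt u i (v ++ w) ↔ OccursAt u i v ∧ OccursAt u (i + v.length) w := by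
  induction v generalizing i with
  | nil => simp [OccursAt]
  | cons a v ih =>
    simp only [List.cons_append, OccursAt, ih, List.length_cons, and_assoc]
    rw [show i + 1 + v.length = i + (v.length + 1) by omega]

theorem occursAt_replicate {i k : ℕ} {a : A} :
    OccursAt u i (List.replicate k a) ↔ ∀ j < k, u (i + j) = a := by
  induction k generalizing i with
  | zero => simp [OccursAt]
  | succ k ih =>
    rw [List.replicate_succ, OccursAt, ih, Nat.forall_lt_succ_left]
    simp [add_assoc, add_comm 1]

theorem OccursAt.eq_of_length_eq {i : ℕ} {v w : List A} (hv : OccursAt u i v)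
    (hw : OccursAt u i w) (h : v.length = w.length) : v = w := by
  induction v generalizing i w with
  | nil => simpa [eq_comm] using h
  | cons a v ih =>
    cases w with
    | nil => simp at h
    | cons b w =>
      rw [ih hv.2 hw.2 (by simpa using h), ← hv.1, ← hw.1]

theorem occursAt_map_range (i n : ℕ) :
    OccursAt u i ((List.range n).map fun j => u (i + j)) := by
  induction n with
  | zero => simp [OccursAt]
  | succ n ih => simp [List.range_succ, occursAt_append, ih, OccursAt]

theorem isFactor_iff {w : List A} : IsFactor u w ↔ ∃ i, OccursAt u i w := by
  refine exists_congr fun i => ⟨fun h => ?_, fun h => ?_⟩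
  · rw [h]
    exact occursAt_map_range i _
  · exact h.eq_of_length_eq (occursAt_map_range i _) (by simp)

theorem exists_eq_replicate_append [DecidableEq A] (z : A) {p : List A}
    (hp : p ≠ List.replicate p.length z) :
    ∃ i x r, x ≠ z ∧ p = List.replicate i z ++ x :: r := by
  induction p with
  | nil => simp at hp
  | cons a p ih =>
    by_cases ha : a = z
    · subst ha
      obtain ⟨i, x, r, hx, hr⟩ := ih (fun h => hp (by
        rw [List.length_cons, List.replicate_succ, ← h]))
      exact ⟨i + 1, x, r, hx, by rw [List.replicate_succ, List.cons_append, ← hr]⟩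
    · exact ⟨0, a, p, ha, rfl⟩

theorem replicate_append_cons_inj {z x y : A} {i j : ℕ} {v w : List A} (hx : x ≠ z) (hy : y ≠ z)
    (h : List.replicate i z ++ x :: v = List.replicate j z ++ y :: w) : i = j := by
  induction i generalizing j with
  | zero =>
    cases j with
    | zero => rfl
    | succ j => simp [List.replicate_succ, hx] at h
  | succ i ih =>
    cases j with
    | zero => simp [List.replicate_succ, hy.symm] at h
    | succ j =>
      simp only [List.replicate_succ, List.cons_append, List.cons.injEq, true_and] at h
      rw [ih h]

theorem replicate_ne_replicate_append_cons {z x : A} {i j : ℕ} {v : List A} (hx : x ≠ z) :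
    List.replicate i z ≠ List.replicate j z ++ x :: v := by
  intro h
  have : x ∈ List.replicate i z := by simp [h]
  exact hx (List.eq_of_mem_replicate this)

end Words

/-! ### The substitution on finite words -/

section Morphism

variable {m t s : ℕ} [NeZero m]

theorem fin_add_one_eq_zero_iff (hm : 2 ≤ m) (a : Fin m) : a + 1 = 0 ↔ ¬ (a : ℕ) + 1 < m := by
  obtain ⟨m, rfl⟩ := Nat.exists_eq_add_of_le' hm
  rw [Fin.ext_iff, Fin.val_add]
  have := a.2
  simp only [Fin.val_one, Fin.val_zero]
  by_cases h : (a : ℕ) + 1 < m + 2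
  · rw [Nat.mod_eq_of_lt h]; omega
  · rw [show (a : ℕ) + 1 = m + 2 by omega]; simp

theorem confSubst_of_ne (hm : 2 ≤ m) {a : Fin m} (ha : a + 1 ≠ 0) :
    confSubst m t s a = List.replicate t 0 ++ [a + 1] := by
  have h : (a : ℕ) + 1 < m := by
    by_contra h
    exact ha ((fin_add_one_eq_zero_iff hm a).2 h)
  rw [confSubst, dif_pos h]
  congr 2
  obtain ⟨m, rfl⟩ := Nat.exists_eq_add_of_le' hm
  rw [Fin.ext_iff, Fin.val_add]
  simp [Nat.mod_eq_of_lt h]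

theorem confSubst_of_eq (hm : 2 ≤ m) {a : Fin m} (ha : a + 1 = 0) :
    confSubst m t s a = List.replicate s 0 := by
  rw [confSubst, dif_neg ((fin_add_one_eq_zero_iff hm a).1 ha)]

theorem one_ne_zero_of_two_le (hm : 2 ≤ m) : (1 : Fin m) ≠ 0 := by
  obtain ⟨m, rfl⟩ := Nat.exists_eq_add_of_le' hm
  simp

/-- The map `w ↦ φ(w) 0^t`, which commutes with reversal. -/
def palLift (m t s : ℕ) [NeZero m] (w : List (Fin m)) : List (Fin m) :=
  applyMorphism (confSubst m t s) w ++ List.replicate t 0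

theorem palLift_cons (a : Fin m) (w : List (Fin m)) :
    palLift m t s (a :: w) = confSubst m t s a ++ palLift m t s w := by
  simp [palLift, applyMorphism]

theorem length_add_le_length_palLift (hm : 2 ≤ m) (hs : 1 ≤ s) (w : List (Fin m)) :
    w.length + t ≤ (palLift m t s w).length := by
  rw [palLift, List.length_append, List.length_replicate]
  refine Nat.add_le_add_right (length_le_applyMorphism _ (fun a ha => ?_) w) t
  by_cases h : a + 1 = 0
  · rw [confSubst_of_eq hm h] at ha
    simp at ha
    omega
  · rw [confSubst_of_ne hm h] at ha
    simp at ha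

theorem palV_succ_succ (k : ℕ) : palV m t s (k + 2) = palLift m t s (palV m t s (k + 1)) := rfl

theorem palU_succ_succ (k : ℕ) : palU m t s (k + 2) = palLift m t s (palU m t s (k + 1)) := rfl

theorem replicate_append_reverse_confSubst (hm : 2 ≤ m) (a : Fin m) :
    List.replicate t 0 ++ (confSubst m t s a).reverse =
      confSubst m t s a ++ List.replicate t 0 := by
  by_cases ha : a + 1 = 0
  · simp [confSubst_of_eq hm ha, add_comm]
  · simp [confSubst_of_ne hm ha]

theorem reverse_palLift (hm : 2 ≤ m) (w : List (Fin m)) :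
    (palLift m t s w).reverse = palLift m t s w.reverse := by
  simp only [palLift, List.reverse_append, List.reverse_replicate]
  induction w with
  | nil => simp [applyMorphism]
  | cons a w ih =>
    simp only [applyMorphism, List.flatMap_cons, List.reverse_append, List.reverse_cons,
      List.flatMap_append, List.flatMap_nil, List.append_nil, List.append_assoc] at ih ⊢
    rw [← replicate_append_reverse_confSubst hm, ← List.append_assoc, ih, List.append_assoc]

theorem palLift_zero_cons (hm : 2 ≤ m) (w : List (Fin m)) :
    palLift m t s (0 :: w) = List.replicate t 0 ++ 1 :: palLift m t s w := by
  have h := one_ne_zero_of_two_le hm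
  rw [palLift_cons, confSubst_of_ne hm (by simpa using h)]
  simp

theorem exists_palLift_eq_replicate_append (hm : 2 ≤ m) (w : List (Fin m)) :
    ∃ r, palLift m t s w = List.replicate t 0 ++ r := by
  induction w with
  | nil => exact ⟨[], by simp [palLift, applyMorphism]⟩
  | cons a w ih =>
    obtain ⟨r, hr⟩ := ih
    rw [palLift_cons]
    by_cases ha : a + 1 = 0
    · refine ⟨List.replicate s 0 ++ r, ?_⟩
      rw [confSubst_of_eq hm ha, hr, ← List.append_assoc, ← List.append_assoc,
        List.replicate_append_replicate, List.replicate_append_replicate, add_comm]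
    · exact ⟨_, by rw [confSubst_of_ne hm ha, List.append_assoc]⟩

theorem exists_palV_eq_zero_cons (hm : 2 ≤ m) (ht : 1 ≤ t) (k : ℕ) :
    ∃ r, palV m t s (k + 1) = 0 :: r := by
  obtain ⟨t, rfl⟩ := Nat.exists_eq_add_of_le' ht
  induction k with
  | zero => exact ⟨_, List.replicate_succ⟩
  | succ k ih =>
    obtain ⟨r, hr⟩ := ih
    rw [palV_succ_succ, hr, palLift_zero_cons hm]
    exact ⟨_, rfl⟩

theorem exists_palU_eq_zero_cons (hm : 2 ≤ m) (ht : 1 ≤ t) (hs : 1 ≤ s) (k : ℕ) :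
    ∃ r, palU m t s (k + 1) = 0 :: r := by
  obtain ⟨t, rfl⟩ := Nat.exists_eq_add_of_le' ht
  induction k with
  | zero =>
    obtain ⟨n, hn⟩ : ∃ n, t + 1 + s - 1 = n + 1 := ⟨t + s - 1, by omega⟩
    exact ⟨List.replicate n 0, by rw [zero_add, palU, hn, List.replicate_succ]⟩
  | succ k ih =>
    obtain ⟨r, hr⟩ := ih
    rw [palU_succ_succ, hr, palLift_zero_cons hm]
    exact ⟨_, rfl⟩

theorem exists_palV_eq_replicate_append (hm : 2 ≤ m) (ht : 1 ≤ t) (k : ℕ) :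
    ∃ r, palV m t s (k + 2) = List.replicate t 0 ++ 1 :: r := by
  obtain ⟨r, hr⟩ := exists_palV_eq_zero_cons (s := s) hm ht k
  exact ⟨_, by rw [palV_succ_succ, hr, palLift_zero_cons hm]⟩

theorem exists_palU_eq_replicate_append (hm : 2 ≤ m) (ht : 1 ≤ t) (hs : 1 ≤ s) (k : ℕ) :
    ∃ r, palU m t s (k + 2) = List.replicate t 0 ++ 1 :: r := by
  obtain ⟨r, hr⟩ := exists_palU_eq_zero_cons hm ht hs k
  exact ⟨_, by rw [palU_succ_succ, hr, palLift_zero_cons hm]⟩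

theorem reverse_palV (hm : 2 ≤ m) (k : ℕ) :
    (palV m t s (k + 1)).reverse = palV m t s (k + 1) := by
  induction k with
  | zero => simp [palV]
  | succ k ih => rw [palV_succ_succ, reverse_palLift hm, ih]

theorem reverse_palU (hm : 2 ≤ m) (k : ℕ) :
    (palU m t s (k + 1)).reverse = palU m t s (k + 1) := by
  induction k with
  | zero => simp [palU]
  | succ k ih => rw [palU_succ_succ, reverse_palLift hm, ih]

end Morphism

/-! ### The block structure of the fixed point -/

/-- The position at which the image of the `n`-th letter starts in `u = φ(u)`. -/
def blockStart (t s : ℕ) {m : ℕ} [NeZero m] (u : ℕ → Fin m) (n : ℕ) : ℕ :=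
  (applyMorphism (confSubst m t s) (pref u n)).length

section BlockStart

variable {m t s : ℕ} [NeZero m] {u : ℕ → Fin m}

theorem blockStart_succ_eq_add_length (n : ℕ) :
    blockStart t s u (n + 1) = blockStart t s u n + (confSubst m t s (u n)).length := by
  simp [blockStart, applyMorphism, pref, List.range_succ]

theorem blockStart_zero : blockStart t s u 0 = 0 := by simp [blockStart, pref, applyMorphism]

theorem blockStart_add_length {n : ℕ} {w : List (Fin m)} (hw : OccursAt u n w) :
    blockStart t s u (n + w.length) =
      blockStart t s u n + (applyMorphism (confSubst m t s) w).length := by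
  induction w generalizing n with
  | nil => simp [applyMorphism]
  | cons a w ih =>
    obtain ⟨rfl, hw⟩ := hw
    have := ih hw
    rw [blockStart_succ_eq_add_length] at this
    rw [List.length_cons, show n + (w.length + 1) = n + 1 + w.length by omega, this]
    simp [applyMorphism, add_assoc]

end BlockStart

/-- The standing assumptions on the parameters and on the infinite word. -/
structure IsConfluentWord (m t s : ℕ) [NeZero m] (u : ℕ → Fin m) : Prop where
  two_le_m : 2 ≤ m
  two_le_s : 2 ≤ s
  s_le_t : s ≤ t
  fixed : IsFixedPoint (confSubst m t s) u

namespace IsConfluentWord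

variable {m t s : ℕ} [NeZero m] {u : ℕ → Fin m} (h : IsConfluentWord m t s u)

include h

theorem one_ne_zero : (1 : Fin m) ≠ 0 := one_ne_zero_of_two_le h.two_le_m

theorem occursAt_blockStart (n : ℕ) : OccursAt u (blockStart t s u n) (confSubst m t s (u n)) := by
  have h1 := h.fixed n
  have h2 := h.fixed (n + 1)
  have h3 : pref u (n + 1) = pref u n ++ [u n] := by simp [pref, List.range_succ]
  have h4 : OccursAt u 0 (applyMorphism (confSubst m t s) (pref u (n + 1))) := by
    rw [h2]
    simpa [pref] using occursAt_map_range (u := u) 0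
      (applyMorphism (confSubst m t s) (pref u (n + 1))).length
  rw [h3, applyMorphism, List.flatMap_append, occursAt_append] at h4
  simpa [blockStart, applyMorphism] using h4.2

theorem blockStart_succ_of_ne {n : ℕ} (hn : u n + 1 ≠ 0) :
    blockStart t s u (n + 1) = blockStart t s u n + (t + 1) := by
  rw [blockStart_succ_eq_add_length, confSubst_of_ne h.two_le_m hn]
  simp

theorem blockStart_succ_of_eq {n : ℕ} (hn : u n + 1 = 0) :
    blockStart t s u (n + 1) = blockStart t s u n + s := by
  rw [blockStart_succ_eq_add_length, confSubst_of_eq h.two_le_m hn]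
  simp

theorem blockStart_strictMono : StrictMono (blockStart t s u) := by
  refine strictMono_nat_of_lt_succ fun n => ?_
  have := h.two_le_s
  by_cases hn : u n + 1 = 0
  · rw [h.blockStart_succ_of_eq hn]; omega
  · rw [h.blockStart_succ_of_ne hn]; omega

theorem exists_mem_block (i : ℕ) :
    ∃ n, blockStart t s u n ≤ i ∧ i < blockStart t s u (n + 1) := by
  induction i with
  | zero =>
    refine ⟨0, blockStart_zero.le, ?_⟩
    exact (Nat.zero_le _).trans_lt (h.blockStart_strictMono (Nat.lt_add_one 0))
  | succ i ih =>
    obtain ⟨n, h1, h2⟩ := ih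
    by_cases hi : i + 1 < blockStart t s u (n + 1)
    · exact ⟨n, by omega, hi⟩
    · exact ⟨n + 1, by omega,
        (by omega : i + 1 ≤ blockStart t s u (n + 1)).trans_lt
          (h.blockStart_strictMono (Nat.lt_add_one (n + 1)))⟩

theorem apply_add_of_lt_s (n : ℕ) {j : ℕ} (hj : j < s) : u (blockStart t s u n + j) = 0 := by
  have h1 := h.occursAt_blockStart n
  have := h.s_le_t
  by_cases hn : u n + 1 = 0
  · rw [confSubst_of_eq h.two_le_m hn] at h1
    exact occursAt_replicate.1 h1 j hj
  · rw [confSubst_of_ne h.two_le_m hn, occursAt_append] at h1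
    exact occursAt_replicate.1 h1.1 j (by omega)

/-- Nonzero letters occur only as last letters of images `0^t (a+1)`, `a ≠ m - 1`. -/
theorem exists_of_apply_ne_zero {i : ℕ} (hi : u i ≠ 0) :
    ∃ n, i = blockStart t s u n + t ∧ u n + 1 ≠ 0 := by
  obtain ⟨n, h1, h2⟩ := h.exists_mem_block i
  obtain ⟨j, rfl⟩ := Nat.exists_eq_add_of_le h1
  have h3 := h.occursAt_blockStart n
  by_cases hn : u n + 1 = 0
  · rw [h.blockStart_succ_of_eq hn] at h2
    exact absurd (h.apply_add_of_lt_s n (by omega)) hi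
  · rw [h.blockStart_succ_of_ne hn] at h2
    rw [confSubst_of_ne h.two_le_m hn, occursAt_append, occursAt_replicate] at h3
    refine ⟨n, ?_, hn⟩
    by_contra hj
    exact hi (h3.1 j (by omega))

theorem apply_succ_eq_zero {i : ℕ} (hi : u i ≠ 0) : u (i + 1) = 0 := by
  obtain ⟨n, rfl, hn⟩ := h.exists_of_apply_ne_zero hi
  have := h.two_le_s
  have h1 := h.apply_add_of_lt_s (n + 1) (j := 0) (by omega)
  rwa [h.blockStart_succ_of_ne hn] at h1

theorem ne_zero_of_add_one_eq_zero {a : Fin m} (ha : a + 1 = 0) : a ≠ 0 := by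
  rintro rfl
  exact h.one_ne_zero (by simpa using ha)

theorem apply_succ_of_add_one_eq_zero {n : ℕ} (hn : u n + 1 = 0) : u (n + 1) = 0 :=
  h.apply_succ_eq_zero (h.ne_zero_of_add_one_eq_zero hn)

theorem occursAt_blockStart_of_apply_eq_zero {n : ℕ} (hn : u n = 0) :
    (∀ j < t, u (blockStart t s u n + j) = 0) ∧ u (blockStart t s u n + t) = 1 := by
  have h1 := h.occursAt_blockStart n
  rw [confSubst_of_ne h.two_le_m (by simpa [hn] using h.one_ne_zero), occursAt_append,
    occursAt_replicate] at h1
  refine ⟨h1.1, ?_⟩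
  simpa [OccursAt, hn] using h1.2

theorem apply_add_of_lt (n : ℕ) {j : ℕ} (hj : j < t) : u (blockStart t s u n + j) = 0 := by
  by_cases hn : u n + 1 = 0
  · by_cases hjs : j < s
    · exact h.apply_add_of_lt_s n hjs
    · have h1 := (h.occursAt_blockStart_of_apply_eq_zero
        (h.apply_succ_of_add_one_eq_zero hn)).1 (j - s) (by omega)
      rw [h.blockStart_succ_of_eq hn] at h1
      rwa [show blockStart t s u n + s + (j - s) = blockStart t s u n + j by omega] at h1
  · have h1 := h.occursAt_blockStart n
    rw [confSubst_of_ne h.two_le_m hn, occursAt_append, occursAt_replicate] at h1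
    exact h1.1 j hj

/-- The letter at distance `t` from the start of the `n`-th block determines `u n`, for
`u n = m - 1` too: then the block `0^s` is followed by `0^t 1`. -/
theorem apply_add_t (n : ℕ) : u (blockStart t s u n + t) = u n + 1 := by
  by_cases hn : u n + 1 = 0
  · have := h.two_le_s
    have := h.s_le_t
    have h1 := (h.occursAt_blockStart_of_apply_eq_zero
      (h.apply_succ_of_add_one_eq_zero hn)).1 (t - s) (by omega)
    rw [h.blockStart_succ_of_eq hn] at h1
    rw [show blockStart t s u n + t = blockStart t s u n + s + (t - s) by omega, h1, hn]
  · have h1 := h.occursAt_blockStart n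
    rw [confSubst_of_ne h.two_le_m hn, occursAt_append, occursAt_replicate] at h1
    simpa [OccursAt] using h1.2

theorem apply_blockStart_succ_sub_one (n : ℕ) : u (blockStart t s u (n + 1) - 1) = u n + 1 := by
  by_cases hn : u n + 1 = 0
  · have := h.two_le_s
    rw [h.blockStart_succ_of_eq hn, Nat.add_sub_assoc (by omega), hn]
    exact h.apply_add_of_lt_s n (by omega)
  · rw [h.blockStart_succ_of_ne hn]
    exact h.apply_add_t n

theorem apply_zero : u 0 = 0 := by
  have := h.two_le_s
  simpa [blockStart_zero] using h.apply_add_of_lt_s 0 (j := 0) (by omega)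

/-- If `u n = m - 1`, the images of `u n` and `u (n+1) = 0` merge into `0^(s+t) 1`. -/
theorem apply_add_of_add_one_eq_zero {n : ℕ} (hn : u n + 1 = 0) :
    (∀ j < t + s, u (blockStart t s u n + j) = 0) ∧ u (blockStart t s u n + (t + s)) = 1 := by
  have h1 := h.blockStart_succ_of_eq hn
  have h2 := h.occursAt_blockStart_of_apply_eq_zero (h.apply_succ_of_add_one_eq_zero hn)
  rw [h1] at h2
  refine ⟨fun j hj => ?_, ?_⟩
  · by_cases hjs : j < s
    · exact h.apply_add_of_lt_s n hjs
    · have := h2.1 (j - s) (by omega)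
      rwa [show blockStart t s u n + s + (j - s) = blockStart t s u n + j by omega] at this
  · rw [← h2.2]
    congr 1
    omega

theorem apply_pred_of_add_one_eq_zero {n : ℕ} (hn : u (n + 1) + 1 = 0) : u n = 0 := by
  by_contra hne
  exact h.ne_zero_of_add_one_eq_zero hn (h.apply_succ_eq_zero hne)

theorem exists_apply_eq (a : Fin m) : ∃ n, u n = a := by
  have key : ∀ k : ℕ, ∃ n, u n = Fin.ofNat m k := by
    intro k
    induction k with
    | zero => exact ⟨0, by simpa using h.apply_zero⟩
    | succ k ih =>
      obtain ⟨n, hn⟩ := ih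
      refine ⟨_, (h.apply_add_t n).trans ?_⟩
      rw [hn, Fin.ext_iff, Fin.val_add]
      simp
  simpa using key a

/-! ### Desubstitution -/

theorem occursAt_palLift_iff {n : ℕ} {w : List (Fin m)} :
    OccursAt u (blockStart t s u n) (palLift m t s w) ↔ OccursAt u n w := by
  induction w generalizing n with
  | nil =>
    simp only [palLift, applyMorphism, List.flatMap_nil, List.nil_append, OccursAt, iff_true,
      occursAt_replicate]
    exact fun j hj => h.apply_add_of_lt n hj
  | cons a w ih =>
    rw [palLift_cons, occursAt_append, OccursAt, ← ih]
    constructor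
    · rintro ⟨h1, h2⟩
      suffices hu : u n = a by
        subst hu
        exact ⟨rfl, by rwa [blockStart_succ_eq_add_length]⟩
      have h3 := h.apply_add_t n
      refine add_right_cancel (h3.symm.trans ?_ : u n + 1 = a + 1)
      by_cases ha : a + 1 = 0
      · -- `0^s` is followed by a word starting with `0^t`, so the letter at distance `t` is `0`
        have := h.two_le_s
        have := h.s_le_t
        obtain ⟨r, hr⟩ := exists_palLift_eq_replicate_append (t := t) (s := s) h.two_le_m w
        rw [confSubst_of_eq h.two_le_m ha, List.length_replicate, hr, occursAt_append,
          occursAt_replicate] at h2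
        rw [ha, ← h2.1 (t - s) (by omega)]
        congr 1
        omega
      · rw [confSubst_of_ne h.two_le_m ha, occursAt_append] at h1
        simpa [OccursAt] using h1.2
    · rintro ⟨rfl, h2⟩
      exact ⟨h.occursAt_blockStart n, by rwa [blockStart_succ_eq_add_length] at h2⟩

theorem eq_of_palLift_eq {n : ℕ} {v w : List (Fin m)} (hv : OccursAt u n v)
    (hvw : palLift m t s v = palLift m t s w) : v = w := by
  have hw : OccursAt u n w := by
    rw [← h.occursAt_palLift_iff, ← hvw, h.occursAt_palLift_iff]
    exact hv
  refine hv.eq_of_length_eq hw ?_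
  have h1 := congrArg List.length hvw
  simp only [palLift, List.length_append, add_left_inj] at h1
  have h2 : blockStart t s u (n + v.length) = blockStart t s u (n + w.length) := by
    rw [blockStart_add_length hv, blockStart_add_length hw, h1]
  have := h.blockStart_strictMono.injective h2
  omega

theorem occursAt_cons_palLift_iff {n : ℕ} {c d : Fin m} {w : List (Fin m)} :
    OccursAt u (blockStart t s u (n + 1) - 1) ((c + 1) :: palLift m t s w ++ [d + 1]) ↔
      OccursAt u n (c :: w ++ [d]) := by
  have hpos : blockStart t s u (n + 1) - 1 + 1 = blockStart t s u (n + 1) := by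
    have := h.blockStart_strictMono (Nat.lt_add_one n)
    omega
  simp only [List.cons_append, OccursAt, occursAt_append, hpos, h.apply_blockStart_succ_sub_one,
    h.occursAt_palLift_iff, add_left_inj, and_true]
  refine and_congr_right fun _ => and_congr_right fun hw => ?_
  rw [palLift, List.length_append, List.length_replicate, ← add_assoc,
    ← blockStart_add_length hw, h.apply_add_t, add_left_inj]

/-- An occurrence of `φ(w) 0^t` starts at a block if `φ(w)` starts with `0^t x`, `x ≠ 0`. -/
theorem exists_blockStart_of_occursAt {i : ℕ} {a : Fin m} {w : List (Fin m)} (ha : a + 1 ≠ 0)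
    (hi : OccursAt u i (palLift m t s (a :: w))) : ∃ n, i = blockStart t s u n := by
  rw [palLift_cons, confSubst_of_ne h.two_le_m ha, occursAt_append, occursAt_append] at hi
  have h1 : u (i + t) = a + 1 := by simpa [OccursAt] using hi.1.2
  obtain ⟨n, hn, -⟩ := h.exists_of_apply_ne_zero (h1 ▸ ha)
  exact ⟨n, by omega⟩

theorem isFactor_cons_palLift_iff {a c d : Fin m} {w : List (Fin m)} (ha : a + 1 ≠ 0) :
    IsFactor u ((c + 1) :: palLift m t s (a :: w) ++ [d + 1]) ↔
      IsFactor u (c :: (a :: w) ++ [d]) := by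
  rw [isFactor_iff, isFactor_iff]
  constructor
  · rintro ⟨i, hi⟩
    have h1 : OccursAt u (i + 1) (palLift m t s (a :: w)) :=
      (occursAt_append.1 (show OccursAt u i ((c + 1) :: (palLift m t s (a :: w) ++ [d + 1]))
        from hi).2).1
    obtain ⟨n, hn⟩ := h.exists_blockStart_of_occursAt ha h1
    cases n with
    | zero => rw [blockStart_zero] at hn; omega
    | succ n =>
      exact ⟨n, h.occursAt_cons_palLift_iff.1 (by rwa [← hn])⟩
  · rintro ⟨n, hn⟩
    exact ⟨_, h.occursAt_cons_palLift_iff.2 hn⟩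

/-- Palindromic extensions of `w` and of `φ(w) 0^t` correspond by `c ↦ c + 1` modulo `m`. -/
theorem palExt_palLift {a : Fin m} {w : List (Fin m)} (ha : a + 1 ≠ 0) :
    palExt u (palLift m t s (a :: w)) = (· + 1) '' palExt u (a :: w) := by
  ext c
  constructor
  · intro hc
    refine ⟨c - 1, ?_, sub_add_cancel c 1⟩
    refine (h.isFactor_cons_palLift_iff ha).1 ?_
    rwa [sub_add_cancel]
  · rintro ⟨d, hd, rfl⟩
    exact (h.isFactor_cons_palLift_iff ha).2 hd

theorem ncard_palExt_palLift {a : Fin m} {w : List (Fin m)} (ha : a + 1 ≠ 0) :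
    (palExt u (palLift m t s (a :: w))).ncard = (palExt u (a :: w)).ncard := by
  rw [h.palExt_palLift ha, Set.ncard_image_of_injective _ (add_left_injective 1)]

/-! ### Palindromic extensions -/

/-- After a nonzero letter and `i ≠ t` zeros, the next letter is determined by `i`. -/
theorem apply_after_zeros {p i : ℕ} (hp : u p ≠ 0) (hz : ∀ j < i, u (p + 1 + j) = 0)
    (hi : i ≠ t) : i ≤ t + s ∧ u (p + 1 + i) = if i = t + s then 1 else 0 := by
  obtain ⟨n, rfl, hn⟩ := h.exists_of_apply_ne_zero hp
  have h2s := h.two_le_s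
  rw [add_assoc _ t 1, ← h.blockStart_succ_of_ne hn] at hz ⊢
  rcases lt_or_gt_of_ne hi with hit | hit
  · exact ⟨by omega, by rw [h.apply_add_of_lt _ hit, if_neg (by omega)]⟩
  · have h1 : u (n + 1) + 1 = 0 := by rw [← h.apply_add_t, hz t hit]
    obtain ⟨h2, h3⟩ := h.apply_add_of_add_one_eq_zero h1
    have h4 : i ≤ t + s := by
      by_contra h4
      rw [hz (t + s) (by omega)] at h3
      exact h.one_ne_zero h3.symm
    refine ⟨h4, ?_⟩
    split_ifs with h5
    · rw [h5, h3]
    · exact h2 i (by omega)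

/-- Before `i ≠ t` zeros and a nonzero letter, the preceding letter is determined by `i`. -/
theorem apply_before_zeros {p i : ℕ} (hp : u (p + i) ≠ 0) (hz : ∀ j < i, u (p + j) = 0)
    (hi : i ≠ t) : 1 ≤ p ∧ u (p - 1) = if i = t + s then 1 else 0 := by
  obtain ⟨n, hn, hne⟩ := h.exists_of_apply_ne_zero hp
  have h2s := h.two_le_s
  rcases lt_or_gt_of_ne hi with hit | hit
  · refine ⟨by omega, ?_⟩
    rw [if_neg (by omega), show p - 1 = blockStart t s u n + (t - i - 1) by omega]
    exact h.apply_add_of_lt _ (by omega)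
  · cases n with
    | zero => rw [blockStart_zero] at hn; omega
    | succ n =>
      have h1 : u n + 1 = 0 := by
        rw [← h.apply_blockStart_succ_sub_one, ← hz (i - t - 1) (by omega)]
        congr 1
        omega
      cases n with
      | zero => exact absurd h.apply_zero (h.ne_zero_of_add_one_eq_zero h1)
      | succ n =>
        have h2 := h.blockStart_succ_of_eq h1
        have h3 := h.apply_blockStart_succ_sub_one n
        have h4 := h.blockStart_strictMono (Nat.lt_add_one n)
        rw [h.apply_pred_of_add_one_eq_zero h1, zero_add] at h3
        have h5 : i ≤ t + s := by
          by_contra h5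
          have := hz (i - (t + s) - 1) (by omega)
          rw [show p + (i - (t + s) - 1) = blockStart t s u (n + 1) - 1 by omega, h3] at this
          exact h.one_ne_zero this
        refine ⟨by omega, ?_⟩
        split_ifs with h6
        · rw [← h3]
          congr 1
          omega
        · rw [show p - 1 = blockStart t s u (n + 1) + (t + s - i - 1) by omega]
          exact (h.apply_add_of_add_one_eq_zero h1).1 _ (by omega)

theorem palExt_of_ne {i : ℕ} {x : Fin m} {r : List (Fin m)} (hx : x ≠ 0) (hi : i ≠ t)
    (hf : IsFactor u (List.replicate i 0 ++ x :: r))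
    (hr : (List.replicate i 0 ++ x :: r).reverse = List.replicate i 0 ++ x :: r) :
    palExt u (List.replicate i 0 ++ x :: r) = {if i = t + s then 1 else 0} := by
  have key : ∀ p, OccursAt u p (List.replicate i 0 ++ x :: r) →
      (1 ≤ p ∧ u (p - 1) = if i = t + s then 1 else 0) ∧
        u (p + (List.replicate i 0 ++ x :: r).length) = if i = t + s then 1 else 0 := by
    intro p hp
    have hp' := hp
    rw [← hr] at hp'
    rw [occursAt_append, occursAt_replicate, List.length_replicate, OccursAt] at hp
    simp only [List.reverse_append, List.reverse_cons, List.reverse_replicate, occursAt_append,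
      List.length_append, List.length_reverse, List.length_singleton, occursAt_replicate,
      OccursAt, and_true] at hp'
    refine ⟨h.apply_before_zeros (by rwa [hp.2.1]) hp.1 hi, ?_⟩
    have h1 := (h.apply_after_zeros (p := p + r.length) (i := i) (by rwa [hp'.1.2])
      (fun j hj => by rw [← hp'.2 j hj, add_assoc p]) hi).2
    rw [← h1]
    congr 1
    simp only [List.length_append, List.length_replicate, List.length_cons]
    omega
  ext c
  constructor
  · intro hc
    obtain ⟨p, hp⟩ := isFactor_iff.1 hc
    have hp : u p = c ∧ OccursAt u (p + 1) ((List.replicate i 0 ++ x :: r) ++ [c]) := hp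
    have := (key _ (occursAt_append.1 hp.2).1).1.2
    rwa [Nat.add_sub_cancel, hp.1] at this
  · intro hc
    rw [Set.mem_singleton_iff] at hc
    obtain ⟨p, hp⟩ := isFactor_iff.1 hf
    obtain ⟨⟨h1, h2⟩, h3⟩ := key p hp
    refine isFactor_iff.2 ⟨p - 1, ?_⟩
    have : OccursAt u (p - 1) (c :: ((List.replicate i 0 ++ x :: r) ++ [c])) := by
      refine ⟨h2.trans hc.symm, ?_⟩
      rw [Nat.sub_add_cancel h1, occursAt_append]
      exact ⟨hp, h3.trans hc.symm, trivial⟩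
    exact this

theorem isFactor_replicate_zero_iff {i : ℕ} :
    IsFactor u (List.replicate i 0) ↔ i ≤ t + s := by
  rw [isFactor_iff]
  simp only [occursAt_replicate]
  constructor
  · rintro ⟨p, hp⟩
    by_contra! hi
    have hne : ∀ q, p ≤ q → q < p + i → u q = 0 := fun q h1 h2 => by
      rw [← hp (q - p) (by omega), Nat.add_sub_cancel' h1]
    obtain ⟨n, h1, h2⟩ := h.exists_mem_block p
    by_cases hn : u n + 1 = 0
    · rw [h.blockStart_succ_of_eq hn] at h2
      refine h.one_ne_zero ?_
      rw [← (h.apply_add_of_add_one_eq_zero hn).2]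
      exact hne _ (by omega) (by omega)
    · rw [h.blockStart_succ_of_ne hn] at h2
      refine hn ?_
      rw [← h.apply_add_t]
      exact hne _ (by omega) (by omega)
  · intro hi
    -- `-1` is the letter `m - 1`, whose image starts a run of `t + s` zeros
    obtain ⟨n, hn⟩ := h.exists_apply_eq (-1)
    exact ⟨_, fun j hj => (h.apply_add_of_add_one_eq_zero (n := n) (by simp [hn])).1 j (by omega)⟩

theorem zero_mem_palExt_replicate_zero_iff {i : ℕ} :
    0 ∈ palExt u (List.replicate i 0) ↔ i + 2 ≤ t + s := by
  rw [← h.isFactor_replicate_zero_iff, List.replicate_succ, List.replicate_succ']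
  rfl

theorem mem_palExt_replicate_zero_iff {i : ℕ} {c : Fin m} (hc : c ≠ 0) :
    c ∈ palExt u (List.replicate i 0) ↔ c = 1 ∧ (i = t ∨ i = t + s) := by
  have hocc : ∀ p, OccursAt u p (c :: List.replicate i 0 ++ [c]) ↔
      u p = c ∧ (∀ j < i, u (p + 1 + j) = 0) ∧ u (p + 1 + i) = c := by
    intro p
    simp [OccursAt, occursAt_append, occursAt_replicate]
  rw [palExt, Set.mem_ofPred_eq, isFactor_iff]
  simp only [hocc]
  constructor
  · rintro ⟨p, h1, h2, h3⟩
    by_cases hi : i = t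
    · refine ⟨?_, Or.inl hi⟩
      obtain ⟨n, rfl, hn⟩ := h.exists_of_apply_ne_zero (h1 ▸ hc)
      rw [add_assoc _ t 1, ← h.blockStart_succ_of_ne hn, hi, h.apply_add_t] at h3
      rw [h.apply_add_t] at h1
      have h4 : u (n + 1) = u n := add_right_cancel (h3.trans h1.symm)
      by_cases h5 : u n = 0
      · rw [← h1, h5, zero_add]
      · exact absurd (h4.symm.trans (h.apply_succ_eq_zero h5)) h5
    · have h4 := (h.apply_after_zeros (h1 ▸ hc) h2 hi).2
      rw [h3] at h4
      split_ifs at h4 with h5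
      · exact ⟨h4, Or.inr h5⟩
      · exact absurd h4 hc
  · have h2s := h.two_le_s
    rintro ⟨rfl, rfl | rfl⟩
    · have h1 : u 1 = 0 := by
        have := h.apply_add_of_lt_s 0 (j := 1) (by omega)
        rwa [blockStart_zero] at this
      have h3 : blockStart i s u 1 = blockStart i s u 0 + (i + 1) :=
        h.blockStart_succ_of_ne (by simpa [h.apply_zero] using hc)
      refine ⟨blockStart i s u 0 + i, ?_⟩
      rw [add_assoc _ i 1, ← h3, h.apply_add_t, h.apply_add_t, h.apply_zero, h1]
      exact ⟨by simp, fun j hj => h.apply_add_of_lt _ hj, by simp⟩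
      -- `-1` is the letter `m - 1`, whose image starts a run of `t + s` zeros
    · obtain ⟨n, hn⟩ := h.exists_apply_eq (-1)
      cases n with
      | zero => exact absurd (hn.symm.trans h.apply_zero) (by simpa using hc)
      | succ n =>
        have hn : u (n + 1) + 1 = 0 := by simp [hn]
        have hlt := h.blockStart_strictMono (Nat.lt_add_one n)
        refine ⟨blockStart t s u (n + 1) - 1, ?_⟩
        rw [Nat.sub_add_cancel (by omega), h.apply_blockStart_succ_sub_one,
          h.apply_pred_of_add_one_eq_zero hn]
        exact ⟨by simp, h.apply_add_of_add_one_eq_zero hn⟩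

/-- A palindrome starting with exactly `t` zeros and a nonzero letter is `φ(q) 0^t` for a
shorter palindrome `q`. -/
theorem exists_eq_palLift {x : Fin m} {r : List (Fin m)} (hx : x ≠ 0)
    (hf : IsFactor u (List.replicate t 0 ++ x :: r))
    (hr : (List.replicate t 0 ++ x :: r).reverse = List.replicate t 0 ++ x :: r) :
    ∃ a w, a + 1 ≠ 0 ∧ IsFactor u (a :: w) ∧ (a :: w).reverse = a :: w ∧
      List.replicate t 0 ++ x :: r = palLift m t s (a :: w) := by
  obtain ⟨p, hp⟩ := isFactor_iff.1 hf
  have hp1 := hp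
  have hp2 := hp
  rw [← hr] at hp2
  rw [occursAt_append, OccursAt, List.length_replicate] at hp1
  simp only [List.reverse_append, List.reverse_cons, List.reverse_replicate, occursAt_append,
    List.length_append, List.length_reverse, List.length_singleton, occursAt_replicate,
    OccursAt, and_true] at hp2
  obtain ⟨n, hn, hne⟩ := h.exists_of_apply_ne_zero (i := p + t) (by rwa [hp1.2.1])
  obtain ⟨k, hk, hke⟩ := h.exists_of_apply_ne_zero (i := p + r.length) (by rwa [hp2.1.2])
  obtain rfl : p = blockStart t s u n := by omega
  have hk1 := h.blockStart_succ_of_ne hke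
  have hnk : n < k + 1 := h.blockStart_strictMono.lt_iff_lt.1 (by omega)
  obtain ⟨d, hd⟩ : ∃ d, k + 1 = n + (d + 1) := ⟨k - n, by omega⟩
  set w := (List.range d).map fun j => u (n + 1 + j) with hw
  have hocc : OccursAt u n (u n :: w) := ⟨rfl, occursAt_map_range _ _⟩
  have hlen : (applyMorphism (confSubst m t s) (u n :: w)).length = r.length + 1 := by
    have h1 := blockStart_add_length (t := t) (s := s) hocc
    have h2 : (u n :: w).length = d + 1 := by simp [hw]
    rw [h2, ← hd] at h1
    omega
  have heq : List.replicate t 0 ++ x :: r = palLift m t s (u n :: w) := by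
    refine hp.eq_of_length_eq (h.occursAt_palLift_iff.2 hocc) ?_
    rw [palLift, List.length_append, List.length_append, hlen]
    simp [add_comm]
  refine ⟨u n, w, hne, isFactor_iff.2 ⟨n, hocc⟩, ?_, heq⟩
  refine (h.eq_of_palLift_eq hocc ?_).symm
  rw [← reverse_palLift h.two_le_m, ← heq, hr]

theorem isFactor_palLift {w : List (Fin m)} (hw : IsFactor u w) :
    IsFactor u (palLift m t s w) := by
  obtain ⟨n, hn⟩ := isFactor_iff.1 hw
  exact isFactor_iff.2 ⟨_, h.occursAt_palLift_iff.2 hn⟩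

theorem isFactor_palV (k : ℕ) : IsFactor u (palV m t s (k + 1)) := by
  induction k with
  | zero => exact h.isFactor_replicate_zero_iff.2 (by omega)
  | succ k ih => exact h.isFactor_palLift ih

theorem isFactor_palU (k : ℕ) : IsFactor u (palU m t s (k + 1)) := by
  induction k with
  | zero => exact h.isFactor_replicate_zero_iff.2 (by omega)
  | succ k ih => exact h.isFactor_palLift ih

theorem ncard_palExt_replicate_zero {i : ℕ} (hi : i ≤ t + s) :
    (palExt u (List.replicate i 0)).ncard + (if i = t + s - 1 then 1 else 0) =
      1 + (if i = t then 1 else 0) := by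
  have h2s := h.two_le_s
  have h2t := h.s_le_t
  have h10 := h.one_ne_zero
  have key : ∀ c, c ∈ palExt u (List.replicate i 0) ↔
      (c = 0 ∧ i + 2 ≤ t + s) ∨ (c = 1 ∧ (i = t ∨ i = t + s)) := by
    intro c
    by_cases hc : c = 0
    · subst hc
      simp [h.zero_mem_palExt_replicate_zero_iff, h10.symm]
    · simp [h.mem_palExt_replicate_zero_iff hc, hc]
  rcases eq_or_ne i t with h1 | h1
  · have : palExt u (List.replicate i 0) = {0, 1} := by
      ext c
      rw [key]
      simp [h1, h2s]
    rw [this, Set.ncard_pair h10.symm, if_neg (by omega), if_pos h1]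
  · rw [if_neg h1]
    rcases eq_or_ne i (t + s - 1) with h2 | h2
    · have : palExt u (List.replicate i 0) = ∅ := by
        ext c
        simp only [key, Set.mem_empty_iff_false, iff_false]
        omega
      rw [this, Set.ncard_empty, if_pos h2]
    · rw [if_neg h2]
      rcases eq_or_ne i (t + s) with h3 | h3
      · have : palExt u (List.replicate i 0) = {1} := by
          ext c
          rw [key]
          simp [h3]
        rw [this, Set.ncard_singleton]
      · have : palExt u (List.replicate i 0) = {0} := by
          ext c
          simp only [key, Set.mem_singleton_iff, h1, h3, or_self, and_false, or_false,
            and_iff_left_iff_imp]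
          omega
        rw [this, Set.ncard_singleton]

theorem replicate_zero_eq_palV_iff {i : ℕ} :
    (∃ k, List.replicate i 0 = palV m t s (k + 1)) ↔ i = t := by
  have h2s := h.two_le_s
  have h2t := h.s_le_t
  constructor
  · rintro ⟨k, hk⟩
    cases k with
    | zero => simpa [palV] using hk
    | succ k =>
      obtain ⟨r, hr⟩ := exists_palV_eq_replicate_append (s := s) (t := t) h.two_le_m (by omega) k
      exact absurd (hk.trans hr) (replicate_ne_replicate_append_cons h.one_ne_zero)
  · rintro rfl
    exact ⟨0, rfl⟩

theorem replicate_zero_eq_palU_iff {i : ℕ} :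
    (∃ k, List.replicate i 0 = palU m t s (k + 1)) ↔ i = t + s - 1 := by
  have h2s := h.two_le_s
  have h2t := h.s_le_t
  constructor
  · rintro ⟨k, hk⟩
    cases k with
    | zero => simpa [palU] using hk
    | succ k =>
      obtain ⟨r, hr⟩ :=
        exists_palU_eq_replicate_append (s := s) (t := t) h.two_le_m (by omega) (by omega) k
      exact absurd (hk.trans hr) (replicate_ne_replicate_append_cons h.one_ne_zero)
  · rintro rfl
    exact ⟨0, rfl⟩

open Classical in
/-- A palindromic factor has exactly one palindromic extension, except that `V^(k)` has two
and `U^(k)` has none. -/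
theorem ncard_palExt {p : List (Fin m)} (hf : IsFactor u p) (hp : p.reverse = p) :
    (palExt u p).ncard + (if ∃ k, p = palU m t s (k + 1) then 1 else 0) =
      1 + (if ∃ k, p = palV m t s (k + 1) then 1 else 0) := by
  have h2s := h.two_le_s
  have h2t := h.s_le_t
  induction hl : p.length using Nat.strong_induction_on generalizing p with
  | _ l ih =>
  subst hl
  by_cases hz : p = List.replicate p.length 0
  · generalize p.length = i at hz
    subst hz
    simp only [h.replicate_zero_eq_palU_iff, h.replicate_zero_eq_palV_iff]
    exact h.ncard_palExt_replicate_zero (h.isFactor_replicate_zero_iff.1 hf)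
  · obtain ⟨i, x, r, hx, rfl⟩ := exists_eq_replicate_append 0 hz
    have hV : ∀ k, List.replicate i 0 ++ x :: r = palV m t s (k + 1) → i = t ∧ 1 ≤ k := by
      intro k hk
      cases k with
      | zero => exact absurd hk.symm (replicate_ne_replicate_append_cons hx)
      | succ k =>
        obtain ⟨r', hr⟩ :=
          exists_palV_eq_replicate_append (s := s) (t := t) h.two_le_m (by omega) k
        exact ⟨replicate_append_cons_inj hx h.one_ne_zero (hk.trans hr), by omega⟩
    have hU : ∀ k, List.replicate i 0 ++ x :: r = palU m t s (k + 1) → i = t ∧ 1 ≤ k := by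
      intro k hk
      cases k with
      | zero => exact absurd hk.symm (replicate_ne_replicate_append_cons hx)
      | succ k =>
        obtain ⟨r', hr⟩ :=
          exists_palU_eq_replicate_append (s := s) (t := t) h.two_le_m (by omega) (by omega) k
        exact ⟨replicate_append_cons_inj hx h.one_ne_zero (hk.trans hr), by omega⟩
    by_cases hi : i = t
    · subst hi
      obtain ⟨a, w, ha, hfw, hpw, heq⟩ := h.exists_eq_palLift hx hf hp
      obtain ⟨n, hn⟩ := isFactor_iff.1 hfw
      have hV' : (∃ k, List.replicate i 0 ++ x :: r = palV m i s (k + 1)) ↔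
          ∃ k, a :: w = palV m i s (k + 1) := by
        constructor
        · rintro ⟨k, hk⟩
          obtain ⟨k, rfl⟩ := Nat.exists_eq_add_of_le' (hV k hk).2
          exact ⟨k, h.eq_of_palLift_eq hn (heq.symm.trans hk)⟩
        · rintro ⟨k, hk⟩
          exact ⟨k + 1, by rw [heq, hk, palV_succ_succ]⟩
      have hU' : (∃ k, List.replicate i 0 ++ x :: r = palU m i s (k + 1)) ↔
          ∃ k, a :: w = palU m i s (k + 1) := by
        constructor
        · rintro ⟨k, hk⟩
          obtain ⟨k, rfl⟩ := Nat.exists_eq_add_of_le' (hU k hk).2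
          exact ⟨k, h.eq_of_palLift_eq hn (heq.symm.trans hk)⟩
        · rintro ⟨k, hk⟩
          exact ⟨k + 1, by rw [heq, hk, palU_succ_succ]⟩
      simp only [hV', hU']
      rw [heq, h.ncard_palExt_palLift ha]
      refine ih _ ?_ hfw hpw rfl
      have := length_add_le_length_palLift (t := i) (s := s) h.two_le_m (by omega) (a :: w)
      rw [heq]
      omega
    · rw [if_neg (fun ⟨k, hk⟩ => hi (hU k hk).1), if_neg (fun ⟨k, hk⟩ => hi (hV k hk).1),
        h.palExt_of_ne hx hi hf hp, Set.ncard_singleton]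

end IsConfluentWord

/-! ### Lengths of `V^(k)` and `U^(k)` -/

section Lengths

variable {m t s : ℕ} [NeZero m]

theorem cons_palLift_sublist (hm : 2 ≤ m) (ht : 1 ≤ t) {v w : List (Fin m)}
    (hvw : List.Sublist (0 :: v) w) :
    List.Sublist (0 :: palLift m t s v) (palLift m t s w) := by
  obtain ⟨t, rfl⟩ := Nat.exists_eq_add_of_le' ht
  refine List.Sublist.trans ?_
    ((hvw.flatMap (confSubst m (t + 1) s)).append_right (List.replicate (t + 1) 0))
  change List.Sublist _ (palLift m (t + 1) s (0 :: v))
  rw [palLift_zero_cons hm, List.replicate_succ, List.cons_append]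
  exact ((List.sublist_cons_self _ _).trans (List.sublist_append_right _ _)).cons_cons 0

theorem cons_palV_sublist_palU (hm : 2 ≤ m) (hs : 2 ≤ s) (hst : s ≤ t) (k : ℕ) :
    List.Sublist (0 :: palV m t s (k + 1)) (palU m t s (k + 1)) := by
  induction k with
  | zero =>
    rw [zero_add, palV, palU, ← List.replicate_succ, List.replicate_sublist_replicate]
    omega
  | succ k ih => exact cons_palLift_sublist hm (by omega) ih

theorem cons_palU_sublist_palV (hm : 2 ≤ m) (hs : 2 ≤ s) (hst : s ≤ t) (k : ℕ) :
    List.Sublist (0 :: palU m t s (k + 1)) (palV m t s (k + 2)) := by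
  induction k with
  | zero =>
    obtain ⟨t', rfl⟩ := Nat.exists_eq_add_of_le' (by omega : 1 ≤ t)
    rw [palV_succ_succ, zero_add, palU, palV, List.replicate_succ, palLift_zero_cons hm,
      ← List.replicate_succ, show t' + 1 + s - 1 + 1 = (t' + 1) + s by omega,
      List.replicate_add]
    refine (List.Sublist.refl _).append (List.Sublist.cons _ ?_)
    obtain ⟨r, hr⟩ := exists_palLift_eq_replicate_append (t := t' + 1) (s := s) hm
      (List.replicate t' 0)
    rw [hr]
    exact (List.replicate_sublist_replicate 0 |>.2 hst).trans (List.sublist_append_left _ _)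
  | succ k ih => exact cons_palLift_sublist hm (by omega) ih

theorem length_palV_lt_length_palU (hm : 2 ≤ m) (hs : 2 ≤ s) (hst : s ≤ t) (k : ℕ) :
    (palV m t s (k + 1)).length < (palU m t s (k + 1)).length :=
  (cons_palV_sublist_palU hm hs hst k).length_le

theorem length_palU_lt_length_palV (hm : 2 ≤ m) (hs : 2 ≤ s) (hst : s ≤ t) (k : ℕ) :
    (palU m t s (k + 1)).length < (palV m t s (k + 2)).length :=
  (cons_palU_sublist_palV hm hs hst k).length_le

end Lengths

/-! ### Parities of letter counts -/

section ParityVector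

variable {n : ℕ}

/-- Every letter occurs an even number of times in `w`. -/
def AllEven (w : List (Fin n)) : Prop := ∀ b, Even (w.count b)

/-- The letter `a` is the only one that occurs an odd number of times in `w`. -/
def OddOnly (w : List (Fin n)) (a : Fin n) : Prop := ∀ b, Odd (w.count b) ↔ b = a

theorem length_eq_sum_count (w : List (Fin n)) : w.length = ∑ b, w.count b := by
  simpa using (Multiset.sum_count_eq_card (s := Finset.univ) (m := (w : Multiset (Fin n)))
    (fun _ _ => Finset.mem_univ _)).symm

theorem AllEven.even_length {w : List (Fin n)} (hw : AllEven w) : Even w.length := by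
  rw [length_eq_sum_count]
  exact Finset.even_sum _ fun b _ => hw b

theorem OddOnly.odd_length {w : List (Fin n)} {a : Fin n} (hw : OddOnly w a) :
    Odd w.length := by
  rw [length_eq_sum_count, Finset.odd_sum_iff_odd_card_odd]
  have : (Finset.univ.filter fun b => Odd (w.count b)) = {a} := by
    ext b
    simp [hw b]
  rw [this]
  simp

end ParityVector

section Parity

variable {m t s : ℕ} [NeZero m]

/-- Every letter except `m - 1` (here `e`) contributes `t` zeros to `φ(w)`, and `m - 1` contributes
`s`; both sides have `t * w.count e` added, to avoid subtraction. -/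
theorem count_zero_palLift (hm : 2 ≤ m) {e : Fin m} (he : e + 1 = 0) (w : List (Fin m)) :
    (palLift m t s w).count 0 + t * w.count e = t * w.length + s * w.count e + t := by
  induction w with
  | nil => simp [palLift, applyMorphism]
  | cons a w ih =>
    rw [palLift_cons, List.count_append, List.length_cons, List.count_cons]
    by_cases ha : a + 1 = 0
    · obtain rfl : a = e := add_right_cancel (ha.trans he.symm)
      rw [confSubst_of_eq hm ha, List.count_replicate_self]
      simp only [beq_self_eq_true, if_true]
      linarith
    · have hae : a ≠ e := by
        rintro rfl
        exact ha he
      rw [confSubst_of_ne hm ha, List.count_append, List.count_replicate_self]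
      simp only [beq_iff_eq, hae, if_false, List.count_singleton, ha]
      linarith

theorem count_add_one_palLift (hm : 2 ≤ m) {a : Fin m} (ha : a + 1 ≠ 0) (w : List (Fin m)) :
    (palLift m t s w).count (a + 1) = w.count a := by
  induction w with
  | nil => simp [palLift, applyMorphism, List.count_replicate, ha.symm]
  | cons c w ih =>
    rw [palLift_cons, List.count_append, ih, List.count_cons, add_comm]
    by_cases hc : c + 1 = 0
    · have hca : c ≠ a := by
        rintro rfl
        exact ha hc
      simp [confSubst_of_eq hm hc, List.count_replicate, ha.symm, hca]
    · simp [confSubst_of_ne hm hc, List.count_replicate, ha.symm, List.count_singleton]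

theorem AllEven.palLift_of_even (hm : 2 ≤ m) (ht : Even t) {w : List (Fin m)} (hw : AllEven w) :
    AllEven (palLift m t s w) := by
  intro b
  obtain ⟨a, rfl⟩ : ∃ a, b = a + 1 := ⟨b - 1, by simp⟩
  by_cases ha : a + 1 = 0
  · have h1 := count_zero_palLift (t := t) (s := s) hm ha w
    have h2 := congrArg (Even : ℕ → Prop) h1
    rw [ha]
    simpa [Nat.even_add, Nat.even_mul, hw a, ht] using h2
  · rw [count_add_one_palLift hm ha]
    exact hw a

theorem AllEven.palLift_of_odd (hm : 2 ≤ m) (ht : Odd t) {w : List (Fin m)} (hw : AllEven w) :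
    OddOnly (palLift m t s w) 0 := by
  intro b
  obtain ⟨a, rfl⟩ : ∃ a, b = a + 1 := ⟨b - 1, by simp⟩
  rw [← Nat.not_even_iff_odd] at ht ⊢
  by_cases ha : a + 1 = 0
  · have h1 := count_zero_palLift (t := t) (s := s) hm ha w
    have h2 := congrArg (Even : ℕ → Prop) h1
    rw [ha]
    simpa [Nat.even_add, Nat.even_mul, hw a, ht, hw.even_length] using h2
  · rw [count_add_one_palLift hm ha]
    simp [hw a, ha]

theorem OddOnly.palLift_of_ne (hm : 2 ≤ m) {a : Fin m} (ha : a + 1 ≠ 0) {w : List (Fin m)}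
    (hw : OddOnly w a) : OddOnly (palLift m t s w) (a + 1) := by
  intro b
  obtain ⟨c, rfl⟩ : ∃ c, b = c + 1 := ⟨b - 1, by simp⟩
  by_cases hc : c + 1 = 0
  · have h1 := count_zero_palLift (t := t) (s := s) hm hc w
    have h2 := congrArg (Even : ℕ → Prop) h1
    have h3 := hw.odd_length
    have h4 : Even (w.count c) := by
      rw [← Nat.not_odd_iff_even, hw c]
      rintro rfl
      exact ha hc
    rw [← Nat.not_even_iff_odd] at h3 ⊢
    rw [hc]
    simp only [Nat.even_add, Nat.even_mul, h3, h4] at h2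
    simp only [ha.symm, iff_false, not_not]
    tauto
  · rw [count_add_one_palLift hm hc, hw c, add_left_inj]

theorem OddOnly.palLift_of_eq_of_odd (hm : 2 ≤ m) (hst : Odd (s + t)) {a : Fin m}
    (ha : a + 1 = 0) {w : List (Fin m)} (hw : OddOnly w a) : OddOnly (palLift m t s w) 0 := by
  intro b
  obtain ⟨c, rfl⟩ : ∃ c, b = c + 1 := ⟨b - 1, by simp⟩
  by_cases hc : c + 1 = 0
  · obtain rfl : c = a := add_right_cancel (hc.trans ha.symm)
    have h1 := count_zero_palLift (t := t) (s := s) hm hc w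
    have h2 := congrArg (Even : ℕ → Prop) h1
    have h3 := hw.odd_length
    have h4 := (hw c).2 rfl
    rw [← Nat.not_even_iff_odd] at h3 h4 hst ⊢
    rw [hc]
    simp only [Nat.even_add, Nat.even_mul, h3, h4] at h2 hst
    simp only [iff_true]
    tauto
  · rw [count_add_one_palLift hm hc, hw c]
    simp only [hc, iff_false]
    rintro rfl
    exact hc ha

theorem OddOnly.palLift_of_eq_of_even (hm : 2 ≤ m) (hst : Even (s + t)) {a : Fin m}
    (ha : a + 1 = 0) {w : List (Fin m)} (hw : OddOnly w a) : AllEven (palLift m t s w) := by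
  intro b
  obtain ⟨c, rfl⟩ : ∃ c, b = c + 1 := ⟨b - 1, by simp⟩
  by_cases hc : c + 1 = 0
  · obtain rfl : c = a := add_right_cancel (hc.trans ha.symm)
    have h1 := count_zero_palLift (t := t) (s := s) hm hc w
    have h2 := congrArg (Even : ℕ → Prop) h1
    have h3 := hw.odd_length
    have h4 := (hw c).2 rfl
    rw [← Nat.not_even_iff_odd] at h3 h4
    rw [hc]
    simp only [Nat.even_add, Nat.even_mul, h3, h4] at h2 hst
    tauto
  · rw [count_add_one_palLift hm hc, ← Nat.not_odd_iff_even, hw c]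
    rintro rfl
    exact hc ha

theorem allEven_replicate_zero {k : ℕ} (hk : Even k) :
    AllEven (List.replicate k (0 : Fin m)) := by
  intro b
  rw [List.count_replicate]
  split_ifs
  exacts [hk, Even.zero]

theorem oddOnly_replicate_zero {k : ℕ} (hk : Odd k) :
    OddOnly (List.replicate k (0 : Fin m)) 0 := by
  intro b
  rw [List.count_replicate]
  by_cases hb : b = 0
  · simp [hb, hk]
  · simp [hb, Ne.symm hb]

theorem ofNat_add_one (r : ℕ) : Fin.ofNat m r + 1 = Fin.ofNat m (r + 1) := by
  rw [Fin.ext_iff, Fin.val_add]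
  simp

variable {W : ℕ → List (Fin m)} (hW : ∀ k, W (k + 1) = palLift m t s (W k))

include hW

/-- The odd count moves from the letter `0` through the letters `1, …, m - 1`. -/
theorem OddOnly.iterate (hm : 2 ≤ m) {k : ℕ} (hk : OddOnly (W k) 0) {r : ℕ} (hr : r < m) :
    OddOnly (W (k + r)) (Fin.ofNat m r) := by
  induction r with
  | zero => exact hk
  | succ r ih =>
    rw [← ofNat_add_one, ← add_assoc, hW]
    refine (ih (by omega)).palLift_of_ne hm ?_
    rw [Ne, fin_add_one_eq_zero_iff hm, not_not]
    rwa [Fin.val_ofNat, Nat.mod_eq_of_lt (by omega)]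

theorem OddOnly.allEven_iterate (hm : 2 ≤ m) (hst : Even (s + t)) {k : ℕ}
    (hk : OddOnly (W k) 0) : AllEven (W (k + m)) := by
  obtain ⟨r, hr⟩ : ∃ r, m = r + 1 := ⟨m - 1, by omega⟩
  have h1 := hW (k + r)
  rw [show k + r + 1 = k + m by omega] at h1
  rw [h1]
  refine (hk.iterate hW hm (by omega)).palLift_of_eq_of_even hm hst ?_
  rw [fin_add_one_eq_zero_iff hm, Fin.val_ofNat, Nat.mod_eq_of_lt (by omega)]
  omega

theorem AllEven.iterate (hm : 2 ≤ m) (ht : Even t) {k : ℕ} (hk : AllEven (W k)) (r : ℕ) :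
    AllEven (W (k + r)) := by
  induction r with
  | zero => exact hk
  | succ r ih => rw [← add_assoc, hW]; exact ih.palLift_of_even hm ht

/-- If `s + t` is odd, the odd count returns from the letter `m - 1` to the letter `0`, so there
is always exactly one. -/
theorem OddOnly.odd_length_iterate (hm : 2 ≤ m) (hst : Odd (s + t)) {k : ℕ}
    (hk : OddOnly (W k) 0) (r : ℕ) : Odd (W (k + r)).length := by
  suffices ∃ a, OddOnly (W (k + r)) a from this.elim fun a ha => ha.odd_length
  induction r with
  | zero => exact ⟨0, hk⟩
  | succ r ih =>
    obtain ⟨a, ha⟩ := ih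
    rw [← add_assoc, hW]
    by_cases h : a + 1 = 0
    · exact ⟨0, ha.palLift_of_eq_of_odd hm hst h⟩
    · exact ⟨_, ha.palLift_of_ne hm h⟩

/-- If `s` and `t` are odd, the counts modulo 2 run through the `m` unit vectors and the zero
vector with period `m + 1`. -/
theorem OddOnly.even_length_iff (hm : 2 ≤ m) (hs : Odd s) (ht : Odd t) (h0 : OddOnly (W 0) 0)
    (k : ℕ) : Even (W k).length ↔ k + 1 ≡ 0 [MOD m + 1] := by
  have hd : ∀ d, OddOnly (W ((m + 1) * d)) 0 := by
    intro d
    induction d with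
    | zero => exact h0
    | succ d ih =>
      rw [Nat.mul_succ, ← add_assoc, hW]
      exact (ih.allEven_iterate hW hm (hs.add_odd ht)).palLift_of_odd hm ht
  have hr := Nat.mod_lt k (by omega : 0 < m + 1)
  have hk := Nat.div_add_mod k (m + 1)
  rw [Nat.modEq_zero_iff_dvd]
  by_cases h : k % (m + 1) = m
  · rw [h] at hk
    rw [← hk]
    refine iff_of_true ((hd _).allEven_iterate hW hm (hs.add_odd ht)).even_length ?_
    rw [add_assoc, ← Nat.mul_succ]
    exact dvd_mul_right _ _
  · have h1 := ((hd (k / (m + 1))).iterate hW hm (r := k % (m + 1)) (by omega)).odd_length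
    rw [hk] at h1
    refine iff_of_false (Nat.not_even_iff_odd.2 h1) fun h2 => h ?_
    have h3 := Nat.mod_eq_zero_of_dvd h2
    rw [Nat.add_mod, Nat.mod_eq_of_lt (by omega : 1 < m + 1)] at h3
    by_contra h4
    rw [Nat.mod_eq_of_lt (by omega)] at h3
    omega

end Parity

/-! ### Counting palindromes -/

section Counting

variable {A : Type*} {u : ℕ → A}

/-- The palindromic factors of `u` of length `n`. -/
def palSet (u : ℕ → A) (n : ℕ) : Set (List A) :=
  {w | IsFactor u w ∧ w.length = n ∧ w.reverse = w}

theorem palSet_finite [Finite A] (n : ℕ) : (palSet u n).Finite :=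
  (List.finite_length_eq A n).subset fun _ hw => hw.2.1

/-- Every palindrome of length `n + 2` is a palindromic extension of its middle part. -/
theorem palComplexity_add_two [Finite A] (n : ℕ) :
    palComplexity u (n + 2) =
      ∑ p ∈ (palSet_finite (u := u) n).toFinset, (palExt u p).ncard := by
  classical
  change (palSet u (n + 2)).ncard = _
  rw [Set.ncard_eq_toFinset_card _ (palSet_finite (n + 2)),
    Finset.card_eq_sum_card_fiberwise (f := fun w => w.tail.dropLast)
      (t := (palSet_finite (u := u) n).toFinset)]
  · refine Finset.sum_congr rfl fun p hp => ?_
    rw [Set.Finite.mem_toFinset] at hp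
    obtain ⟨-, hp2, hp3⟩ := hp
    rw [← Set.ncard_image_of_injective (palExt u p)
      (f := fun c => c :: p ++ [c]) (fun c d hcd => by simpa using hcd),
      ← Set.ncard_coe_finset]
    congr 1
    ext w
    simp only [Finset.coe_filter, Set.Finite.mem_toFinset, Set.mem_ofPred_eq, Set.mem_image]
    constructor
    · rintro ⟨⟨h1, h2, h3⟩, h4⟩
      obtain ⟨c, w, rfl⟩ := List.exists_cons_of_length_eq_add_one h2
      obtain ⟨w, d, rfl⟩ := (List.eq_nil_or_concat w).resolve_left (by rintro rfl; simp at h2)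
      simp only [List.concat_eq_append, List.tail_cons, List.dropLast_concat] at *
      subst h4
      obtain rfl : d = c := by simpa using congrArg List.head? h3
      exact ⟨d, h1, rfl⟩
    · rintro ⟨c, hc, rfl⟩
      refine ⟨⟨hc, by simp [hp2], by simp [hp3]⟩, by simp⟩
  · intro w hw
    rw [Set.Finite.coe_toFinset] at hw ⊢
    obtain ⟨h1, h2, h3⟩ := hw
    obtain ⟨c, w, rfl⟩ := List.exists_cons_of_length_eq_add_one h2
    obtain ⟨w, d, rfl⟩ := (List.eq_nil_or_concat w).resolve_left (by rintro rfl; simp at h2)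
    simp only [List.concat_eq_append, List.tail_cons, List.dropLast_concat] at *
    refine ⟨?_, by simpa using h2, ?_⟩
    · obtain ⟨i, hi⟩ := isFactor_iff.1 h1
      exact isFactor_iff.2 ⟨i + 1, (occursAt_append.1 hi.2).1⟩
    · simp only [List.reverse_cons, List.reverse_append, List.reverse_nil, List.nil_append,
        List.cons_append, List.cons.injEq] at h3
      exact (List.append_inj' h3.2 rfl).1

theorem palComplexity_zero : palComplexity u 0 = 1 := by
  have : {w : List A | IsFactor u w ∧ w.length = 0 ∧ w.reverse = w} = {[]} := by
    ext w
    simp only [Set.mem_ofPred_eq, Set.mem_singleton_iff, List.length_eq_zero_iff]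
    constructor
    · exact fun h => h.2.1
    · rintro rfl
      exact ⟨isFactor_iff.2 ⟨0, trivial⟩, rfl, rfl⟩
  rw [palComplexity, this, Set.ncard_singleton]

theorem palComplexity_one (hu : Function.Surjective u) : palComplexity u 1 = Nat.card A := by
  have : {w : List A | IsFactor u w ∧ w.length = 1 ∧ w.reverse = w} =
      (fun a => [a]) '' Set.univ := by
    ext w
    simp only [Set.mem_ofPred_eq, Set.image_univ, Set.mem_range, List.length_eq_one_iff]
    constructor
    · rintro ⟨-, ⟨a, rfl⟩, -⟩
      exact ⟨a, rfl⟩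
    · rintro ⟨a, rfl⟩
      obtain ⟨i, hi⟩ := hu a
      exact ⟨isFactor_iff.2 ⟨i, hi, trivial⟩, ⟨a, rfl⟩, rfl⟩
  rw [palComplexity, this, Set.ncard_image_of_injective _ (fun a b h => by simpa using h),
    Set.ncard_univ]

open Classical in
/-- For palindromic factors `W k` of increasing lengths, the palindromes of length `n` among them
correspond to the indices `k` with `|W k| = n`, all of which are at most `n`. -/
theorem sum_ite_exists_eq [Finite A] {W : ℕ → List A} (hW : StrictMono fun k => (W k).length)
    (hf : ∀ k, IsFactor u (W k)) (hr : ∀ k, (W k).reverse = W k) {n K : ℕ} (hK : n ≤ K) :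
    (∑ p ∈ (palSet_finite (u := u) n).toFinset, if ∃ k, p = W k then 1 else 0) =
      {k ∈ Finset.range (K + 1) | (W k).length = n}.card := by
  rw [← Finset.card_filter]
  refine (Finset.card_nbij W ?_ ?_ ?_).symm
  · intro k hk
    simp only [Finset.coe_filter, Set.mem_ofPred_eq] at hk
    simp only [Finset.coe_filter, Set.Finite.mem_toFinset, Set.mem_ofPred_eq]
    exact ⟨⟨hf k, hk.2, hr k⟩, k, rfl⟩
  · intro k _ l _ hkl
    exact hW.injective (congrArg List.length hkl)
  · intro p hp
    simp only [Finset.coe_filter, Set.Finite.mem_toFinset, Set.mem_ofPred_eq] at hp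
    obtain ⟨⟨-, h1, -⟩, k, rfl⟩ := hp
    refine ⟨k, ?_, rfl⟩
    simp only [Finset.coe_filter, Set.mem_ofPred_eq, Finset.mem_range]
    have : k ≤ (W k).length := hW.le_apply
    exact ⟨by omega, h1⟩

/-- Splits the indices `k` with `v k < n` by whether `w k < n`; at most one has
`v k < n ≤ w k`, since `v` and `w` interlace. -/
theorem card_filter_interlacing {v w : ℕ → ℕ} (hvw : ∀ k, v k < w k) (hwv : ∀ k, w k < v (k + 1))
    (Q : ℕ → Prop) [DecidablePred Q] {n K : ℕ} (hK : n ≤ K)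
    [Decidable (∃ k, Q k ∧ v k < n ∧ n ≤ w k)] :
    {k ∈ Finset.range (K + 1) | Q k ∧ v k < n}.card =
      {k ∈ Finset.range (K + 1) | Q k ∧ w k < n}.card +
        if ∃ k, Q k ∧ v k < n ∧ n ≤ w k then 1 else 0 := by
  have hv : StrictMono v := strictMono_nat_of_lt_succ fun k => (hvw k).trans (hwv k)
  have hlt : ∀ {k l}, k < l → w k < v l := fun {k l} hkl =>
    (hwv k).trans_le (hv.monotone hkl)
  rw [← Finset.card_filter_add_card_filter_not (fun k => w k < n)
    (s := {k ∈ Finset.range (K + 1) | Q k ∧ v k < n}), Finset.filter_filter,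
    Finset.filter_filter]
  congr 1
  · congr 1
    refine Finset.filter_congr fun k _ => ?_
    have := hvw k
    constructor
    · rintro ⟨⟨h1, -⟩, h2⟩
      exact ⟨h1, h2⟩
    · rintro ⟨h1, h2⟩
      exact ⟨⟨h1, by omega⟩, h2⟩
  · split_ifs with h
    · obtain ⟨k, hk1, hk2, hk3⟩ := h
      rw [Finset.card_eq_one]
      refine ⟨k, ?_⟩
      ext l
      simp only [Finset.mem_filter, Finset.mem_range, Finset.mem_singleton, not_lt]
      constructor
      · rintro ⟨-, ⟨-, hl2⟩, hl3⟩
        rcases lt_trichotomy l k with hlk | hlk | hlk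
        · have := hlt hlk
          omega
        · exact hlk
        · have := hlt hlk
          omega
      · rintro rfl
        have : l ≤ v l := hv.le_apply
        exact ⟨by omega, ⟨hk1, hk2⟩, hk3⟩
    · rw [Finset.card_eq_zero, Finset.filter_eq_empty_iff]
      rintro k - ⟨⟨h1, h2⟩, h3⟩
      exact h ⟨k, h1, h2, not_lt.1 h3⟩

theorem card_filter_lt_add_two (f : ℕ → ℕ) (n K : ℕ) :
    {k ∈ Finset.range K | (f k % 2 = (n + 2) % 2) ∧ f k < n + 2}.card =
      {k ∈ Finset.range K | (f k % 2 = n % 2) ∧ f k < n}.card +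
        {k ∈ Finset.range K | f k = n}.card := by
  rw [← Finset.card_union_of_disjoint, ← Finset.filter_or]
  · congr 1
    refine Finset.filter_congr fun k _ => ?_
    omega
  · rw [Finset.disjoint_filter]
    omega

end Counting

namespace IsConfluentWord

variable {m t s : ℕ} [NeZero m] {u : ℕ → Fin m} (h : IsConfluentWord m t s u)

include h

theorem length_palV_lt (k : ℕ) : (palV m t s (k + 1)).length < (palU m t s (k + 1)).length :=
  length_palV_lt_length_palU h.two_le_m h.two_le_s h.s_le_t k

theorem length_palU_lt (k : ℕ) : (palU m t s (k + 1)).length < (palV m t s (k + 2)).length :=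
  length_palU_lt_length_palV h.two_le_m h.two_le_s h.s_le_t k

theorem strictMono_length_palV : StrictMono fun k => (palV m t s (k + 1)).length :=
  strictMono_nat_of_lt_succ fun k => (h.length_palV_lt k).trans (h.length_palU_lt k)

theorem strictMono_length_palU : StrictMono fun k => (palU m t s (k + 1)).length :=
  strictMono_nat_of_lt_succ fun k => (h.length_palU_lt k).trans (h.length_palV_lt (k + 1))

/-- The difference `P(n+2) - P(n)`, with the terms arranged to avoid subtraction. -/
theorem palComplexity_add_two_add {n K : ℕ} (hK : n ≤ K) :
    palComplexity u (n + 2) +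
        {k ∈ Finset.range (K + 1) | (palU m t s (k + 1)).length = n}.card =
      palComplexity u n +
        {k ∈ Finset.range (K + 1) | (palV m t s (k + 1)).length = n}.card := by
  classical
  rw [palComplexity_add_two,
    ← sum_ite_exists_eq h.strictMono_length_palU h.isFactor_palU (reverse_palU h.two_le_m) hK,
    ← sum_ite_exists_eq h.strictMono_length_palV h.isFactor_palV (reverse_palV h.two_le_m) hK,
    ← Finset.sum_add_distrib]
  have h1 : palComplexity u n = ∑ p ∈ (palSet_finite (u := u) n).toFinset, 1 := by
    rw [Finset.sum_const, smul_eq_mul, mul_one]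
    exact Set.ncard_eq_toFinset_card _ (palSet_finite n)
  rw [h1, ← Finset.sum_add_distrib]
  refine Finset.sum_congr rfl fun p hp => ?_
  rw [Set.Finite.mem_toFinset] at hp
  exact h.ncard_palExt hp.1 hp.2.2

/-- Summing the differences `P(n+2) - P(n)`: `P(n)` is determined by the numbers of shorter
`V^(k)` and `U^(k)` of the parity of `n`. -/
theorem palComplexity_add_card {n K : ℕ} (hK : n ≤ K) :
    palComplexity u n + {k ∈ Finset.range (K + 1) |
        (palU m t s (k + 1)).length % 2 = n % 2 ∧ (palU m t s (k + 1)).length < n}.card =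
      palComplexity u (n % 2) + {k ∈ Finset.range (K + 1) |
        (palV m t s (k + 1)).length % 2 = n % 2 ∧ (palV m t s (k + 1)).length < n}.card := by
  induction n using Nat.twoStepInduction with
  | zero => simp
  | one =>
    have hV : ∀ k, (palV m t s (k + 1)).length ≠ 0 := fun k hk => by
      have := h.strictMono_length_palV.monotone (Nat.zero_le k)
      have h2s := h.two_le_s
      have h2t := h.s_le_t
      simp only [palV, List.length_replicate] at this
      omega
    have hU : ∀ k, (palU m t s (k + 1)).length ≠ 0 := fun k hk => by
      have := h.length_palV_lt k
      omega
    simp [hU, hV]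
  | more n ih _ =>
    have h1 := ih (by omega)
    have h2 := h.palComplexity_add_two_add (n := n) (K := K) (by omega)
    rw [card_filter_lt_add_two, card_filter_lt_add_two, Nat.add_mod_right]
    omega

theorem palComplexity_mod_two (n : ℕ) :
    palComplexity u (n % 2) = if Even n then 1 else m := by
  split_ifs with hn
  · rw [Nat.even_iff.1 hn, palComplexity_zero]
  · rw [Nat.not_even_iff.1 hn, palComplexity_one h.exists_apply_eq, Nat.card_fin]

/-- The case in which, among the lengths of the parity of `n`, the `U^(k)` occur only for indices
for which the `V^(k)` occur too. -/
theorem palComplexity_eq_of_imp {n : ℕ} {QV QU : ℕ → Prop} [DecidablePred QV]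
    [DecidablePred QU]
    (hV : ∀ k, (palV m t s (k + 1)).length % 2 = n % 2 ↔ QV k)
    (hU : ∀ k, (palU m t s (k + 1)).length % 2 = n % 2 ↔ QU k) (hUV : ∀ k, QU k → QV k)
    [Decidable (∃ k, QU k ∧ (palV m t s (k + 1)).length < n ∧
      n ≤ (palU m t s (k + 1)).length)] :
    palComplexity u n = (if Even n then 1 else m) +
      {k ∈ Finset.range (n + 1) | (QV k ∧ ¬ QU k) ∧ (palV m t s (k + 1)).length < n}.card +
      if ∃ k, QU k ∧ (palV m t s (k + 1)).length < n ∧ n ≤ (palU m t s (k + 1)).length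
        then 1 else 0 := by
  have h1 := h.palComplexity_add_card (le_refl n)
  simp only [hV, hU, h.palComplexity_mod_two] at h1
  have h2 := card_filter_interlacing h.length_palV_lt h.length_palU_lt QU (le_refl n)
  have h3 : {k ∈ Finset.range (n + 1) | QV k ∧ (palV m t s (k + 1)).length < n}.card =
      {k ∈ Finset.range (n + 1) | QU k ∧ (palV m t s (k + 1)).length < n}.card +
      {k ∈ Finset.range (n + 1) |
        (QV k ∧ ¬ QU k) ∧ (palV m t s (k + 1)).length < n}.card := by
    rw [← Finset.card_union_of_disjoint, ← Finset.filter_or]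
    · congr 1
      refine Finset.filter_congr fun k _ => ?_
      have := hUV k
      tauto
    · rw [Finset.disjoint_filter]
      tauto
  omega

/-- The case in which `U^(k)` and `V^(k)` have lengths of the same parity. -/
theorem palComplexity_eq_of_iff {n : ℕ} {Q : ℕ → Prop}
    (hV : ∀ k, (palV m t s (k + 1)).length % 2 = n % 2 ↔ Q k)
    (hU : ∀ k, (palU m t s (k + 1)).length % 2 = n % 2 ↔ Q k)
    [Decidable (∃ k, Q k ∧ (palV m t s (k + 1)).length < n ∧
      n ≤ (palU m t s (k + 1)).length)] :
    palComplexity u n = (if Even n then 1 else m) +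
      if ∃ k, Q k ∧ (palV m t s (k + 1)).length < n ∧ n ≤ (palU m t s (k + 1)).length
        then 1 else 0 := by
  classical
  rw [h.palComplexity_eq_of_imp hV hU (fun _ => id)]
  simp

/-- The case in which no `V^(k)` has a length of the parity of `n`. -/
theorem palComplexity_add_eq {n : ℕ} {QU : ℕ → Prop} [DecidablePred QU]
    (hV : ∀ k, (palV m t s (k + 1)).length % 2 ≠ n % 2)
    (hU : ∀ k, (palU m t s (k + 1)).length % 2 = n % 2 ↔ QU k) :
    palComplexity u n +
      {k ∈ Finset.range (n + 1) | QU k ∧ (palU m t s (k + 1)).length < n}.card =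
      if Even n then 1 else m := by
  have h1 := h.palComplexity_add_card (le_refl n)
  simpa only [hV, hU, h.palComplexity_mod_two, false_and, Finset.filter_false,
    Finset.card_empty, add_zero] using h1

end IsConfluentWord

/-- The indexing of words from `0` and from `1`. -/
theorem card_filter_range_eq {f : ℕ → ℕ} (hf : ∀ k, k ≤ f (k + 1)) (m n : ℕ) :
    {k ∈ Finset.range (n + 1) | k < m ∧ f (k + 1) < n}.card =
      {k ∈ Finset.Icc 1 m | f k < n}.card := by
  refine Finset.card_nbij' (· + 1) (· - 1) ?_ ?_ ?_ ?_
  · intro k hk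
    simp only [Finset.coe_filter, Set.mem_ofPred_eq, Finset.mem_Icc] at hk ⊢
    exact ⟨by omega, hk.2.2⟩
  · intro k hk
    simp only [Finset.coe_filter, Set.mem_ofPred_eq, Finset.mem_Icc, Finset.mem_range] at hk ⊢
    have := hf (k - 1)
    rw [Nat.sub_add_cancel hk.1.1] at this ⊢
    omega
  · intro k _
    simp
  · intro k hk
    simp only [Finset.coe_filter, Set.mem_ofPred_eq, Finset.mem_Icc] at hk
    simp only
    omega

theorem exists_one_le_iff {R : ℕ → Prop} : (∃ k, 1 ≤ k ∧ R k) ↔ ∃ k, R (k + 1) :=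
  ⟨fun ⟨k, hk, hR⟩ => ⟨k - 1, by rwa [Nat.sub_add_cancel hk]⟩,
    fun ⟨k, hR⟩ => ⟨k + 1, by omega, hR⟩⟩

/-! ### Palindromic complexity in the four parity cases -/

namespace IsConfluentWord

variable {m t s : ℕ} [NeZero m] {u : ℕ → Fin m} (h : IsConfluentWord m t s u)

include h

theorem palComplexity_of_odd_even (hs : Odd s) (ht : Even t) (n : ℕ) :
    palComplexity u (2 * n + 1) = m ∧
      ((∃ k, 1 ≤ k ∧ (palV m t s k).length < 2 * n ∧ 2 * n ≤ (palU m t s k).length) →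
        palComplexity u (2 * n) = 2) ∧
      ((¬ ∃ k, 1 ≤ k ∧ (palV m t s k).length < 2 * n ∧ 2 * n ≤ (palU m t s k).length) →
        palComplexity u (2 * n) = 1) := by
  classical
  have hV : ∀ k, (palV m t s (k + 1)).length % 2 = 0 := fun k => by
    have := ((allEven_replicate_zero ht).iterate (W := fun k => palV m t s (k + 1))
      palV_succ_succ h.two_le_m ht (k := 0) k).even_length
    rwa [zero_add, Nat.even_iff] at this
  have hU : ∀ k, (palU m t s (k + 1)).length % 2 = 0 := fun k => by
    have := ((allEven_replicate_zero (by grind)).iterate (W := fun k => palU m t s (k + 1))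
      palU_succ_succ h.two_le_m ht (k := 0) k).even_length
    rwa [zero_add, Nat.even_iff] at this
  have h1 := h.palComplexity_eq_of_iff (n := 2 * n + 1) (Q := fun _ => False)
    (fun k => by simp only [hV, iff_false]; omega) (fun k => by simp only [hU, iff_false]; omega)
  have h2 := h.palComplexity_eq_of_iff (n := 2 * n) (Q := fun _ => True)
    (fun k => by rw [hV]; simp) (fun k => by rw [hU]; simp)
  simp only [exists_one_le_iff]
  refine ⟨by simpa using h1, fun hk => ?_, fun hk => ?_⟩
  · simpa [hk] using h2
  · simpa [hk] using h2

theorem palComplexity_of_odd_odd (hs : Odd s) (ht : Odd t) (n : ℕ) :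
    ((∃ k, 1 ≤ k ∧ ¬ k ≡ 0 [MOD m + 1] ∧
          (palV m t s k).length < 2 * n + 1 ∧ 2 * n + 1 ≤ (palU m t s k).length) →
        palComplexity u (2 * n + 1) = m + 1) ∧
      ((¬ ∃ k, 1 ≤ k ∧ ¬ k ≡ 0 [MOD m + 1] ∧
          (palV m t s k).length < 2 * n + 1 ∧ 2 * n + 1 ≤ (palU m t s k).length) →
        palComplexity u (2 * n + 1) = m) ∧
      ((∃ k, 1 ≤ k ∧ k ≡ 0 [MOD m + 1] ∧
          (palV m t s k).length < 2 * n ∧ 2 * n ≤ (palU m t s k).length) →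
        palComplexity u (2 * n) = 2) ∧
      ((¬ ∃ k, 1 ≤ k ∧ k ≡ 0 [MOD m + 1] ∧
          (palV m t s k).length < 2 * n ∧ 2 * n ≤ (palU m t s k).length) →
        palComplexity u (2 * n) = 1) := by
  classical
  have hV : ∀ k, Even (palV m t s (k + 1)).length ↔ k + 1 ≡ 0 [MOD m + 1] :=
    OddOnly.even_length_iff (W := fun k => palV m t s (k + 1)) palV_succ_succ h.two_le_m hs ht
      (oddOnly_replicate_zero ht)
  have hU : ∀ k, Even (palU m t s (k + 1)).length ↔ k + 1 ≡ 0 [MOD m + 1] :=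
    OddOnly.even_length_iff (W := fun k => palU m t s (k + 1)) palU_succ_succ h.two_le_m hs ht
      (oddOnly_replicate_zero (by grind))
  have h1 := h.palComplexity_eq_of_iff (n := 2 * n + 1) (Q := fun k => ¬ k + 1 ≡ 0 [MOD m + 1])
    (fun k => by rw [← hV, Nat.even_iff]; omega) (fun k => by rw [← hU, Nat.even_iff]; omega)
  have h2 := h.palComplexity_eq_of_iff (n := 2 * n) (Q := fun k => k + 1 ≡ 0 [MOD m + 1])
    (fun k => by rw [← hV, Nat.even_iff]; omega) (fun k => by rw [← hU, Nat.even_iff]; omega)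
  rw [if_neg (by simp)] at h1
  rw [if_pos (by simp)] at h2
  simp only [exists_one_le_iff]
  refine ⟨fun hk => ?_, fun hk => ?_, fun hk => ?_, fun hk => ?_⟩
  · rwa [if_pos hk] at h1
  · rwa [if_neg hk] at h1
  · rwa [if_pos hk] at h2
  · rwa [if_neg hk] at h2

theorem palComplexity_of_even_odd (hs : Even s) (ht : Odd t) (n : ℕ) :
    ((∃ k, 2 ≤ k ∧
          (palV m t s k).length < 2 * n + 1 ∧ 2 * n + 1 ≤ (palU m t s k).length) →
        palComplexity u (2 * n + 1) = m + 2) ∧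
      (2 * n + 1 ≤ (palV m t s 1).length → palComplexity u (2 * n + 1) = m) ∧
      ((¬ ∃ k, 2 ≤ k ∧
          (palV m t s k).length < 2 * n + 1 ∧ 2 * n + 1 ≤ (palU m t s k).length) →
        ¬ 2 * n + 1 ≤ (palV m t s 1).length →
        palComplexity u (2 * n + 1) = m + 1) ∧
      (2 * n ≤ (palU m t s 1).length → palComplexity u (2 * n) = 1) ∧
      (¬ 2 * n ≤ (palU m t s 1).length → palComplexity u (2 * n) = 0) := by
  classical
  have h2s := h.two_le_s
  have hV : ∀ k, (palV m t s (k + 1)).length % 2 = 1 := fun k => by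
    have := (oddOnly_replicate_zero ht).odd_length_iterate (W := fun k => palV m t s (k + 1))
      palV_succ_succ h.two_le_m (hs.add_odd ht) (k := 0) k
    rwa [zero_add, Nat.odd_iff] at this
  have hU0 : (palU m t s 1).length % 2 = 0 := by
    rw [← Nat.even_iff, palU, List.length_replicate]
    grind
  -- `U^(1)` has even letter counts, so `U^(2)` has the parities of `V^(1)`
  have hU1 : OddOnly (palU m t s (0 + 2)) 0 := by
    rw [palU_succ_succ]
    refine (allEven_replicate_zero ?_).palLift_of_odd h.two_le_m ht
    grind
  have hU : ∀ k, (palU m t s (k + 2)).length % 2 = 1 := fun k => by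
    have := hU1.odd_length_iterate (W := fun k => palU m t s (k + 2))
      (fun k => palU_succ_succ (k + 1)) h.two_le_m (hs.add_odd ht) (k := 0) k
    rwa [zero_add, Nat.odd_iff] at this
  have hU' : ∀ k, (palU m t s (k + 1)).length % 2 = 1 ↔ 1 ≤ k := by
    intro k
    cases k with
    | zero => simp [hU0]
    | succ k => simp [hU]
  have h1 := h.palComplexity_eq_of_imp (n := 2 * n + 1) (QV := fun _ => True)
    (QU := fun k => 1 ≤ k) (fun k => by simp [hV])
    (fun k => by rw [← hU']; omega) (fun _ _ => trivial)
  have h2 := h.palComplexity_add_eq (n := 2 * n) (QU := fun k => k = 0)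
    (fun k => by rw [hV]; omega) (fun k => by have := hU' k; omega)
  rw [if_neg (by simp)] at h1
  rw [if_pos (by simp)] at h2
  have h3 : (∃ k, 2 ≤ k ∧
      (palV m t s k).length < 2 * n + 1 ∧ 2 * n + 1 ≤ (palU m t s k).length) ↔
      ∃ k, 1 ≤ k ∧ (palV m t s (k + 1)).length < 2 * n + 1 ∧
        2 * n + 1 ≤ (palU m t s (k + 1)).length :=
    ⟨fun ⟨k, hk, hR⟩ => ⟨k - 1, by omega, by rwa [Nat.sub_add_cancel (by omega)]⟩,
      fun ⟨k, hk, hR⟩ => ⟨k + 1, by omega, hR⟩⟩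
  have h4 : {k ∈ Finset.range (2 * n + 1 + 1) |
      (True ∧ ¬ 1 ≤ k) ∧ (palV m t s (k + 1)).length < 2 * n + 1}.card =
      if (palV m t s 1).length < 2 * n + 1 then 1 else 0 := by
    split_ifs with h4
    · rw [Finset.card_eq_one]
      refine ⟨0, Finset.ext fun k => ?_⟩
      simp only [Finset.mem_filter, Finset.mem_range, Finset.mem_singleton]
      constructor
      · omega
      · rintro rfl
        simpa using h4
    · rw [Finset.card_eq_zero, Finset.filter_eq_empty_iff]
      rintro k - ⟨⟨-, h5⟩, h6⟩
      obtain rfl : k = 0 := by omega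
      exact h4 h6
  have h5 : {k ∈ Finset.range (2 * n + 1) |
      k = 0 ∧ (palU m t s (k + 1)).length < 2 * n}.card =
      if (palU m t s 1).length < 2 * n then 1 else 0 := by
    split_ifs with h4
    · rw [Finset.card_eq_one]
      refine ⟨0, Finset.ext fun k => ?_⟩
      simp only [Finset.mem_filter, Finset.mem_range, Finset.mem_singleton]
      constructor
      · omega
      · rintro rfl
        simpa using h4
    · rw [Finset.card_eq_zero, Finset.filter_eq_empty_iff]
      rintro k - ⟨rfl, h6⟩
      exact h4 h6
  rw [h4, ← h3] at h1
  rw [h5] at h2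
  have h6 : (∃ k, 2 ≤ k ∧
      (palV m t s k).length < 2 * n + 1 ∧ 2 * n + 1 ≤ (palU m t s k).length) →
      (palV m t s 1).length < 2 * n + 1 := by
    rw [h3]
    rintro ⟨k, -, hk, -⟩
    exact (h.strictMono_length_palV.monotone (Nat.zero_le k)).trans_lt hk
  refine ⟨fun hk => ?_, fun hk => ?_, fun hk hk' => ?_, fun hk => ?_, fun hk => ?_⟩
  · rwa [if_pos (h6 hk), if_pos hk] at h1
  · rwa [if_neg (by omega), if_neg (fun hk' => by have := h6 hk'; omega)] at h1
  · rwa [if_pos (by omega), if_neg hk] at h1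
  · rwa [if_neg (by omega)] at h2
  · rw [if_pos (by omega)] at h2
    omega

theorem palComplexity_of_even_even (hs : Even s) (ht : Even t) (n : ℕ) :
    (2 * n + 1 ≤ (palU m t s m).length →
        palComplexity u (2 * n + 1) =
          {k ∈ Finset.Icc 1 m | 2 * n + 1 ≤ (palU m t s k).length}.card) ∧
      (¬ 2 * n + 1 ≤ (palU m t s m).length → palComplexity u (2 * n + 1) = 0) ∧
      ((∃ k, m + 1 ≤ k ∧ (palV m t s k).length < 2 * n ∧ 2 * n ≤ (palU m t s k).length) →
        palComplexity u (2 * n) = m + 2) ∧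
      (2 * n ≤ (palV m t s (m + 1)).length →
        palComplexity u (2 * n) =
          {k ∈ Finset.Icc 1 m | (palV m t s k).length < 2 * n}.card + 1) ∧
      ((¬ ∃ k, m + 1 ≤ k ∧ (palV m t s k).length < 2 * n ∧ 2 * n ≤ (palU m t s k).length) →
        ¬ 2 * n ≤ (palV m t s (m + 1)).length →
        palComplexity u (2 * n) = m + 1) := by
  classical
  have h2s := h.two_le_s
  have hm := h.two_le_m
  have hV : ∀ k, (palV m t s (k + 1)).length % 2 = 0 := fun k => by
    have := ((allEven_replicate_zero ht).iterate (W := fun k => palV m t s (k + 1))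
      palV_succ_succ hm ht (k := 0) k).even_length
    rwa [zero_add, Nat.even_iff] at this
  have hU0 : OddOnly (palU m t s (0 + 1)) 0 := oddOnly_replicate_zero (by grind)
  have hU : ∀ k, (palU m t s (k + 1)).length % 2 = 0 ↔ m ≤ k := by
    intro k
    rcases lt_or_ge k m with hk | hk
    · have := (hU0.iterate (W := fun k => palU m t s (k + 1)) palU_succ_succ hm
        (k := 0) hk).odd_length
      rw [zero_add, Nat.odd_iff] at this
      omega
    · have := ((hU0.allEven_iterate (W := fun k => palU m t s (k + 1)) palU_succ_succ hm
        (hs.add ht) (k := 0)).iterate (W := fun k => palU m t s (k + 1)) palU_succ_succ hm ht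
        (k - m)).even_length
      rw [zero_add, Nat.add_sub_cancel' hk, Nat.even_iff] at this
      omega
  have h1 := h.palComplexity_add_eq (n := 2 * n + 1) (QU := fun k => k < m)
    (fun k => by rw [hV]; omega) (fun k => by have := hU k; omega)
  have h2 := h.palComplexity_eq_of_imp (n := 2 * n) (QV := fun _ => True)
    (QU := fun k => m ≤ k) (fun k => by rw [hV]; simp)
    (fun k => by rw [← hU]; omega) (fun _ _ => trivial)
  rw [if_neg (by simp)] at h1
  rw [if_pos (by simp)] at h2
  simp only [true_and, not_le] at h2
  have h3 : (∃ k, m + 1 ≤ k ∧ (palV m t s k).length < 2 * n ∧ 2 * n ≤ (palU m t s k).length) ↔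
      ∃ k, m ≤ k ∧ (palV m t s (k + 1)).length < 2 * n ∧
        2 * n ≤ (palU m t s (k + 1)).length :=
    ⟨fun ⟨k, hk, hR⟩ => ⟨k - 1, by omega, by rwa [Nat.sub_add_cancel (by omega)]⟩,
      fun ⟨k, hk, hR⟩ => ⟨k + 1, by omega, hR⟩⟩
  rw [card_filter_range_eq (f := fun k => (palU m t s k).length)
    (fun k => h.strictMono_length_palU.le_apply)] at h1
  rw [card_filter_range_eq (f := fun k => (palV m t s k).length)
    (fun k => h.strictMono_length_palV.le_apply), ← h3] at h2
  have h4 := Finset.card_filter_add_card_filter_not (s := Finset.Icc 1 m)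
    (fun k => (palU m t s k).length < 2 * n + 1)
  simp only [not_lt, Nat.card_Icc, Nat.add_sub_cancel] at h4
  have hmono : ∀ {W : ℕ → List (Fin m)}, (StrictMono fun k => (W (k + 1)).length) →
      ∀ k ∈ Finset.Icc 1 m, (W k).length ≤ (W m).length := by
    intro W hW k hk
    rw [Finset.mem_Icc] at hk
    have := hW.monotone (by omega : k - 1 ≤ m - 1)
    simpa [Nat.sub_add_cancel hk.1, Nat.sub_add_cancel (hk.1.trans hk.2)] using this
  have h5 : (∃ k, m + 1 ≤ k ∧
      (palV m t s k).length < 2 * n ∧ 2 * n ≤ (palU m t s k).length) →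
      (palV m t s (m + 1)).length < 2 * n := by
    rw [h3]
    rintro ⟨k, hmk, hk, -⟩
    exact (h.strictMono_length_palV.monotone hmk).trans_lt hk
  have h6 : (palV m t s (m + 1)).length < 2 * n →
      {k ∈ Finset.Icc 1 m | (palV m t s k).length < 2 * n}.card = m := by
    intro hn
    rw [Finset.filter_true_of_mem, Nat.card_Icc, Nat.add_sub_cancel]
    intro k hk
    obtain ⟨r, hr⟩ : ∃ r, m = r + 1 := ⟨m - 1, by omega⟩
    have h7 := hmono (W := palV m t s) h.strictMono_length_palV k hk
    have h8 := h.strictMono_length_palV (Nat.lt_add_one r)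
    simp only [← hr] at h8
    omega
  refine ⟨fun hk => by omega, fun hk => ?_, fun hk => ?_, fun hk => ?_, fun hk hk' => ?_⟩
  · rw [Finset.filter_true_of_mem, Nat.card_Icc, Nat.add_sub_cancel] at h1
    · omega
    · intro k hkm
      have := hmono (W := palU m t s) h.strictMono_length_palU k hkm
      omega
  · rw [if_pos hk, h6 (h5 hk)] at h2
    omega
  · rw [if_neg (fun hk' => by have := h5 hk'; omega)] at h2
    omega
  · rw [if_neg hk, h6 (by omega)] at h2
    omega

end IsConfluentWord

end ParryPal

theorem mainTheorem2 (m t s : ℕ) [NeZero m] (hm : 2 ≤ m) (hs : 2 ≤ s) (hst : s ≤ t)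
    (u : ℕ → Fin m) (hu : IsFixedPoint (confSubst m t s) u) :
    -- `s` odd and `t` even
    (Odd s → Even t → ∀ n : ℕ,
      palComplexity u (2 * n + 1) = m ∧
      ((∃ k, 1 ≤ k ∧ (palV m t s k).length < 2 * n ∧ 2 * n ≤ (palU m t s k).length) →
        palComplexity u (2 * n) = 2) ∧
      ((¬ ∃ k, 1 ≤ k ∧ (palV m t s k).length < 2 * n ∧ 2 * n ≤ (palU m t s k).length) →
        palComplexity u (2 * n) = 1)) ∧
    -- `s` and `t` odd
    (Odd s → Odd t → ∀ n : ℕ,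
      ((∃ k, 1 ≤ k ∧ ¬ k ≡ 0 [MOD m + 1] ∧
          (palV m t s k).length < 2 * n + 1 ∧ 2 * n + 1 ≤ (palU m t s k).length) →
        palComplexity u (2 * n + 1) = m + 1) ∧
      ((¬ ∃ k, 1 ≤ k ∧ ¬ k ≡ 0 [MOD m + 1] ∧
          (palV m t s k).length < 2 * n + 1 ∧ 2 * n + 1 ≤ (palU m t s k).length) →
        palComplexity u (2 * n + 1) = m) ∧
      ((∃ k, 1 ≤ k ∧ k ≡ 0 [MOD m + 1] ∧
          (palV m t s k).length < 2 * n ∧ 2 * n ≤ (palU m t s k).length) →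
        palComplexity u (2 * n) = 2) ∧
      ((¬ ∃ k, 1 ≤ k ∧ k ≡ 0 [MOD m + 1] ∧
          (palV m t s k).length < 2 * n ∧ 2 * n ≤ (palU m t s k).length) →
        palComplexity u (2 * n) = 1)) ∧
    -- `s` even and `t` odd
    (Even s → Odd t → ∀ n : ℕ,
      ((∃ k, 2 ≤ k ∧
          (palV m t s k).length < 2 * n + 1 ∧ 2 * n + 1 ≤ (palU m t s k).length) →
        palComplexity u (2 * n + 1) = m + 2) ∧
      (2 * n + 1 ≤ (palV m t s 1).length → palComplexity u (2 * n + 1) = m) ∧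
      ((¬ ∃ k, 2 ≤ k ∧
          (palV m t s k).length < 2 * n + 1 ∧ 2 * n + 1 ≤ (palU m t s k).length) →
        ¬ 2 * n + 1 ≤ (palV m t s 1).length →
        palComplexity u (2 * n + 1) = m + 1) ∧
      (2 * n ≤ (palU m t s 1).length → palComplexity u (2 * n) = 1) ∧
      (¬ 2 * n ≤ (palU m t s 1).length → palComplexity u (2 * n) = 0)) ∧
    -- `s` and `t` even
    (Even s → Even t → ∀ n : ℕ,
      (2 * n + 1 ≤ (palU m t s m).length →
        palComplexity u (2 * n + 1) =
          {k ∈ Finset.Icc 1 m | 2 * n + 1 ≤ (palU m t s k).length}.card) ∧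
      (¬ 2 * n + 1 ≤ (palU m t s m).length → palComplexity u (2 * n + 1) = 0) ∧
      ((∃ k, m + 1 ≤ k ∧ (palV m t s k).length < 2 * n ∧ 2 * n ≤ (palU m t s k).length) →
        palComplexity u (2 * n) = m + 2) ∧
      (2 * n ≤ (palV m t s (m + 1)).length →
        palComplexity u (2 * n) =
          {k ∈ Finset.Icc 1 m | (palV m t s k).length < 2 * n}.card + 1) ∧
      ((¬ ∃ k, m + 1 ≤ k ∧ (palV m t s k).length < 2 * n ∧ 2 * n ≤ (palU m t s k).length) →
        ¬ 2 * n ≤ (palV m t s (m + 1)).length →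
        palComplexity u (2 * n) = m + 1)) := by
  
  have h : IsConfluentWord m t s u := ⟨hm, hs, hst, hu⟩
  exact ⟨h.palComplexity_of_odd_even, h.palComplexity_of_odd_odd, h.palComplexity_of_even_odd,
    h.palComplexity_of_even_even⟩
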